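/- A \emph{modal algebra} is a Boolean algebra $B$ with an operator $\Diamond : B \to B$ such that $\Diamond\bot=\bot$ and $\Diamond(a\vee b)=\Diamond a\vee\Diamond b$; morphisms of modal algebras are Boolean morphisms preserving $\Diamond$. Let $\mathbf{MA}_f$ be the category of finite modal algebras (a full subcategory of the category of modal algebras; it is essentially small), and let $\mathrm{Pro}\text{-}\mathbf{MA}_f := (\mathrm{Ind}\text{-}(\mathbf{MA}_f^{op}))^{op}$ be its Pro-completion, the category of \emph{profinite modal algebras}, where $\mathrm{Ind}\text{-}\mathcal C$ is the full subcategory of $\mathbf{Set}^{\mathcal C^{op}}$ given by the small filtered colimits of representable functors. Let $\mathbf{CABA}$ be the category of complete atomic Boolean algebras, with the Boolean morphisms preserving arbitrary joins and meets. The forgetful functor $\mathrm{Pro}\text{-}\mathbf{MA}_f \to \mathbf{CABA}$ sends a profinite modal algebra $X$ to its underlying Boolean algebra, i.e. to the limit of the underlying Boolean algebras of the finite modal algebras $A$, taken over all pairs $(A, x)$ with $A$ in $\mathbf{MA}_f$ and $x : X \to A$ in $\mathrm{Pro}\text{-}\mathbf{MA}_f$; the forgetful functor $\mathrm{Pro}\text{-}\mathbf{MA}_f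 \to \mathbf{Set}$ is its composition with the underlying-set functor $\mathbf{CABA}\to\mathbf{Set}$. \textbf{Theorem.} The forgetful functors $\mathrm{Pro}\text{-}\mathbf{MA}_f \to \mathbf{CABA}$ and $\mathrm{Pro}\text{-}\mathbf{MA}_f \to \mathbf{Set}$ are both monadic: each has a left adjoint, and its comparison functor to the category of Eilenberg--Moore algebras for the induced monad is an equivalence of categories. -/

import Mathlib

open CategoryTheory Opposite Limits

universe u

/-! ### Modal algebras -/

/-- A modal algebra: a Boolean algebra with an operator `dia` preserving finite joins. -/
class ModalAlgebra (B : Type u) extends BooleanAlgebra B where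
  /-- The possibility operator. -/
  dia : B → B
  dia_sup : ∀ a b : B, dia (a ⊔ b) = dia a ⊔ dia b
  dia_bot : dia ⊥ = ⊥

/-- Morphisms of modal algebras: Boolean morphisms preserving `dia`. -/
@[ext]
structure ModalHom (A B : Type u) [ModalAlgebra A] [ModalAlgebra B] extends
    BoundedLatticeHom A B where
  map_dia' : ∀ a : A, toFun (ModalAlgebra.dia a) = ModalAlgebra.dia (toFun a)

namespace ModalHom

instance (A B : Type u) [ModalAlgebra A] [ModalAlgebra B] : FunLike (ModalHom A B) A B where
  coe f := f.toFun
  coe_injective f g h := by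
    ext x
    exact congrFun h x

instance (A B : Type u) [ModalAlgebra A] [ModalAlgebra B] :
    BoundedLatticeHomClass (ModalHom A B) A B where
  map_sup f := f.map_sup'
  map_inf f := f.map_inf'
  map_top f := f.map_top'
  map_bot f := f.map_bot'

theorem map_dia {A B : Type u} [ModalAlgebra A] [ModalAlgebra B] (f : ModalHom A B) (a : A) :
    f (ModalAlgebra.dia a) = ModalAlgebra.dia (f a) :=
  f.map_dia' a

/-- The identity morphism. -/
def id (A : Type u) [ModalAlgebra A] : ModalHom A A where
  toBoundedLatticeHom := BoundedLatticeHom.id A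
  map_dia' _ := rfl

/-- Composition of morphisms. -/
def comp {A B C : Type u} [ModalAlgebra A] [ModalAlgebra B] [ModalAlgebra C]
    (g : ModalHom B C) (f : ModalHom A B) : ModalHom A C where
  toBoundedLatticeHom := g.toBoundedLatticeHom.comp f.toBoundedLatticeHom
  map_dia' a := by
    change g (f (ModalAlgebra.dia a)) = ModalAlgebra.dia (g (f a))
    rw [f.map_dia, g.map_dia]

end ModalHom

/-- The objects of the category `MA` of modal algebras. -/
structure ModAlg where
  /-- Bundle a modal algebra. -/
  of ::
  /-- The underlying type. -/
  carrier : Type u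
  [str : ModalAlgebra carrier]

attribute [instance] ModAlg.str

namespace ModAlg

instance : CoeSort ModAlg.{u} (Type u) :=
  ⟨ModAlg.carrier⟩

/-- The morphisms of the category `MA`. -/
@[ext]
structure Hom (A B : ModAlg.{u}) where
  /-- The underlying morphism of modal algebras. -/
  hom' : ModalHom A B

instance : Category.{u} ModAlg.{u} where
  Hom A B := Hom A B
  id A := ⟨ModalHom.id A⟩
  comp f g := ⟨g.hom'.comp f.hom'⟩

instance : ConcreteCategory ModAlg.{u} (fun A B => ModalHom A B) where
  hom := Hom.hom'
  ofHom := Hom.mk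

end ModAlg

/-- The category `MA_f`: the full subcategory of `MA` formed by the finite modal algebras. -/
abbrev FinModAlg : Type (u + 1) :=
  ObjectProperty.FullSubcategory (fun A : ModAlg.{u} => Finite A)

/-! ### Complete atomic Boolean algebras -/

/-- The objects of the category `CABA` of complete atomic Boolean algebras. -/
structure CABA where
  /-- Bundle a complete atomic Boolean algebra. -/
  of ::
  /-- The underlying type. -/
  carrier : Type u
  [str : CompleteAtomicBooleanAlgebra carrier]

attribute [instance] CABA.str

namespace CABA

instance : CoeSort CABA.{u} (Type u) :=
  ⟨CABA.carrier⟩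

/-- The morphisms of `CABA`: maps preserving arbitrary joins and meets (hence also the Boolean
operations). -/
@[ext]
structure Hom (A B : CABA.{u}) where
  /-- The underlying morphism of complete lattices. -/
  hom' : CompleteLatticeHom A B

instance : Category.{u} CABA.{u} where
  Hom A B := Hom A B
  id A := ⟨CompleteLatticeHom.id A⟩
  comp f g := ⟨g.hom'.comp f.hom'⟩

instance : ConcreteCategory CABA.{u} (fun A B => CompleteLatticeHom A B) where
  hom := Hom.hom'
  ofHom := Hom.mk

end CABA

/-! ### Finite modal algebras as complete atomic Boolean algebras -/

namespace FinModAlg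

/-- The complete atomic Boolean algebra structure of a finite modal algebra; it extends the given
Boolean algebra structure. -/
noncomputable instance (A : FinModAlg.{u}) : CompleteAtomicBooleanAlgebra A.obj :=
  haveI : Finite A.obj := A.property
  letI : Fintype A.obj := Fintype.ofFinite A.obj
  Fintype.toCompleteAtomicBooleanAlgebra A.obj

theorem map_sSup {A B : FinModAlg.{u}} (f : A ⟶ B) (s : Set A.obj) :
    f.hom (sSup s) = ⨆ a ∈ s, f.hom a := by
  have : Finite A.obj := A.property
  induction s, s.toFinite using Set.Finite.induction_on with
  | empty =>
    rw [sSup_empty, iSup_emptyset]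
    exact map_bot (ConcreteCategory.hom f.hom)
  | insert _ _ ih =>
    rw [sSup_insert, iSup_insert, ← ih]
    exact map_sup (ConcreteCategory.hom f.hom) _ _

theorem map_sInf {A B : FinModAlg.{u}} (f : A ⟶ B) (s : Set A.obj) :
    f.hom (sInf s) = ⨅ a ∈ s, f.hom a := by
  have : Finite A.obj := A.property
  induction s, s.toFinite using Set.Finite.induction_on with
  | empty =>
    rw [sInf_empty, iInf_emptyset]
    exact map_top (ConcreteCategory.hom f.hom)
  | insert _ _ ih =>
    rw [sInf_insert, iInf_insert, ← ih]
    exact map_inf (ConcreteCategory.hom f.hom) _ _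

end FinModAlg

/-! ### Profinite modal algebras -/

/-- The category `Pro-MA_f` of profinite modal algebras: the opposite of the Ind-completion of the
opposite of `MA_f`. -/
abbrev ProFinModAlg : Type (u + 1) :=
  (Ind (FinModAlg.{u})ᵒᵖ)ᵒᵖ

namespace ProFinModAlg

/-- A profinite modal algebra `X` as a functor `MA_f ⥤ Set`; its value at a finite modal algebra `A`
is the set of morphisms from `X` to `A` in `Pro-MA_f`. -/
noncomputable def toFunctor (X : ProFinModAlg.{u}) : FinModAlg.{u} ⥤ Type u :=
  opOp FinModAlg.{u} ⋙ (Ind.inclusion (FinModAlg.{u})ᵒᵖ).obj X.unop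

/-- A morphism `X ⟶ Y` of profinite modal algebras as a natural transformation in the opposite
direction (precomposition with the morphism). -/
noncomputable def mapFunctor {X Y : ProFinModAlg.{u}} (φ : X ⟶ Y) : toFunctor Y ⟶ toFunctor X :=
  Functor.whiskerLeft (opOp FinModAlg.{u}) ((Ind.inclusion (FinModAlg.{u})ᵒᵖ).map φ.unop)

/-- The underlying set of `X`, up to size: the limit of the underlying sets of the finite modal
algebras `A`, taken over all pairs `(A, x)` with `x` a morphism from `X` to `A`. An element is a
family of elements of the `A` which is compatible with all morphisms of `MA_f`. -/
@[ext]
structure Point (X : ProFinModAlg.{u}) : Type (u + 1) where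
  /-- The component at `(A, x)`. -/
  val : ∀ A : FinModAlg.{u}, (toFunctor X).obj A → A.obj
  compat : ∀ (A B : FinModAlg.{u}) (f : A ⟶ B) (x : (toFunctor X).obj A),
    val B ((toFunctor X).map f x) = f.hom (val A x)

namespace Point

theorem val_injective {X : ProFinModAlg.{u}} :
    Function.Injective (fun s : Point X => s.val) :=
  fun _ _ h => Point.ext h

section

variable {X : ProFinModAlg.{u}}

noncomputable instance : LE (Point X) := ⟨fun s t => s.val ≤ t.val⟩

noncomputable instance : LT (Point X) := ⟨fun s t => s.val < t.val⟩

noncomputable instance : Max (Point X) := ⟨fun s t => ⟨s.val ⊔ t.val, fun A B f x => by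
  simp only [Pi.sup_apply]
  rw [s.compat A B f x, t.compat A B f x]
  exact (map_sup (ConcreteCategory.hom f.hom) _ _).symm⟩⟩

noncomputable instance : Min (Point X) := ⟨fun s t => ⟨s.val ⊓ t.val, fun A B f x => by
  simp only [Pi.inf_apply]
  rw [s.compat A B f x, t.compat A B f x]
  exact (map_inf (ConcreteCategory.hom f.hom) _ _).symm⟩⟩

noncomputable instance : Top (Point X) :=
  ⟨⟨⊤, fun _ _ f _ => (map_top (ConcreteCategory.hom f.hom)).symm⟩⟩

noncomputable instance : Bot (Point X) :=
  ⟨⟨⊥, fun _ _ f _ => (map_bot (ConcreteCategory.hom f.hom)).symm⟩⟩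

noncomputable instance : Compl (Point X) := ⟨fun s => ⟨s.valᶜ, fun A B f x => by
  simp only [Pi.compl_apply]
  rw [s.compat A B f x]
  exact (map_compl' (ConcreteCategory.hom f.hom) _).symm⟩⟩

noncomputable instance : SDiff (Point X) := ⟨fun s t => ⟨s.val \ t.val, fun A B f x => by
  simp only [Pi.sdiff_apply]
  rw [s.compat A B f x, t.compat A B f x]
  exact (map_sdiff' (ConcreteCategory.hom f.hom) _ _).symm⟩⟩

noncomputable instance : HImp (Point X) := ⟨fun s t => t ⊔ sᶜ⟩

noncomputable instance : HNot (Point X) := ⟨fun s => sᶜ⟩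

noncomputable instance : SupSet (Point X) := ⟨fun S =>
  ⟨fun A x => ⨆ s ∈ S, s.val A x, fun A B f x => by
    rw [← sSup_image (f := fun s : Point X => s.val A x), FinModAlg.map_sSup, iSup_image]
    exact iSup_congr fun s => iSup_congr fun _ => s.compat A B f x⟩⟩

noncomputable instance : InfSet (Point X) := ⟨fun S =>
  ⟨fun A x => ⨅ s ∈ S, s.val A x, fun A B f x => by
    rw [← sInf_image (f := fun s : Point X => s.val A x), FinModAlg.map_sInf, iInf_image]
    exact iInf_congr fun s => iInf_congr fun _ => s.compat A B f x⟩⟩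

theorem val_sSup (S : Set (Point X)) : (sSup S).val = ⨆ s ∈ S, s.val := by
  funext A x
  simp only [iSup_apply]
  rfl

theorem val_sInf (S : Set (Point X)) : (sInf S).val = ⨅ s ∈ S, s.val := by
  funext A x
  simp only [iInf_apply]
  rfl

/-- The order and all operations, including arbitrary joins and meets, are componentwise. -/
noncomputable instance : CompleteAtomicBooleanAlgebra (Point X) :=
  Function.Injective.completeAtomicBooleanAlgebra
    (fun s : Point X => s.val) val_injective
    Iff.rfl Iff.rfl (fun _ _ => rfl) (fun _ _ => rfl) val_sSup val_sInf
    rfl rfl (fun _ => rfl)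
    (fun _ _ => himp_eq.symm)
    (fun _ => hnot_eq_compl.symm)
    (fun _ _ => rfl)

/-- The limit is small, since it can be computed on the small diagram presenting `X`. -/
instance small : Small.{u} (Point X) := by
  let P := Ind.presentation X.unop
  let g : Point X → ∀ i : P.I, (P.F.obj i).unop.obj := fun s i =>
    s.val (P.F.obj i).unop ((P.ι.app i).app (op (P.F.obj i)) (𝟙 (P.F.obj i)))
  refine small_of_injective (f := g) fun s t h => Point.ext ?_
  funext A x
  obtain ⟨i, y, hy⟩ := Types.jointly_surjective_of_isColimit
    (isColimitOfPreserves ((evaluation _ _).obj (op (op A))) P.isColimit) x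
  let z : (toFunctor X).obj (P.F.obj i).unop := (P.ι.app i).app (op (P.F.obj i)) (𝟙 (P.F.obj i))
  let y' : (P.F.obj i).unop ⟶ A := Quiver.Hom.unop y
  have hx : x = (toFunctor X).map y' z := by
    have h1 := NatTrans.naturality_apply (P.ι.app i) (Quiver.Hom.op y'.op) (𝟙 (P.F.obj i))
    refine (hy.symm.trans ?_).trans h1
    change (P.ι.app i).app (op (op A)) y = (P.ι.app i).app (op (op A)) (y ≫ 𝟙 (P.F.obj i))
    rw [Category.comp_id]
  have hi : s.val (P.F.obj i).unop z = t.val (P.F.obj i).unop z := congrFun h i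
  rw [hx, s.compat, t.compat, hi]

end

/-- The map on points induced by a morphism `φ` of profinite modal algebras. -/
noncomputable def mapFun {X Y : ProFinModAlg.{u}} (φ : X ⟶ Y) (s : Point X) : Point Y where
  val A y := s.val A ((mapFunctor φ).app A y)
  compat A B f y := by
    rw [← s.compat A B f, NatTrans.naturality_apply]

/-- The induced map on points as a morphism of complete lattices. -/
noncomputable def map {X Y : ProFinModAlg.{u}} (φ : X ⟶ Y) :
    CompleteLatticeHom (Point X) (Point Y) where
  toFun := mapFun φ
  map_sSup' S := by
    refine Point.ext (funext fun A => funext fun y => ?_)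
    change (sSup S).val A ((mapFunctor φ).app A y) = (sSup (mapFun φ '' S)).val A y
    rw [val_sSup, val_sSup]
    simp only [iSup_apply, iSup_image]
    rfl
  map_sInf' S := by
    refine Point.ext (funext fun A => funext fun y => ?_)
    change (sInf S).val A ((mapFunctor φ).app A y) = (sInf (mapFun φ '' S)).val A y
    rw [val_sInf, val_sInf]
    simp only [iInf_apply, iInf_image]
    rfl

theorem map_id (X : ProFinModAlg.{u}) : map (𝟙 X) = CompleteLatticeHom.id (Point X) := by
  ext s A y
  change s.val A ((mapFunctor (𝟙 X)).app A y) = s.val A y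
  simp only [mapFunctor, unop_id, CategoryTheory.Functor.map_id, Functor.whiskerLeft_id']
  rfl

theorem map_comp {X Y Z : ProFinModAlg.{u}} (φ : X ⟶ Y) (ψ : Y ⟶ Z) :
    map (φ ≫ ψ) = (map ψ).comp (map φ) := by
  ext s A y
  change s.val A ((mapFunctor (φ ≫ ψ)).app A y) =
    s.val A ((mapFunctor φ).app A ((mapFunctor ψ).app A y))
  simp only [mapFunctor, unop_comp, Functor.map_comp, Functor.whiskerLeft_comp]
  rfl

end Point

/-- The underlying set of a profinite modal algebra: a copy of `Point X` in the universe of small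
sets. -/
def Carrier (X : ProFinModAlg.{u}) : Type u :=
  Shrink.{u} (Point X)

/-- The bijection between the underlying set and the set of points. -/
noncomputable def carrierEquiv (X : ProFinModAlg.{u}) : Carrier X ≃ Point X :=
  (equivShrink (Point X)).symm

noncomputable instance (X : ProFinModAlg.{u}) : CompleteAtomicBooleanAlgebra (Carrier X) :=
  (carrierEquiv X).completeAtomicBooleanAlgebra

/-- The Boolean algebra structure on the underlying set is the one of `Point X`. -/
noncomputable def carrierIso (X : ProFinModAlg.{u}) : Carrier X ≃o Point X where
  toEquiv := carrierEquiv X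
  map_rel_iff' := Iff.rfl

/-- The map on underlying sets induced by a morphism of profinite modal algebras. -/
noncomputable def carrierMap {X Y : ProFinModAlg.{u}} (φ : X ⟶ Y) :
    CompleteLatticeHom (Carrier X) (Carrier Y) :=
  ((carrierIso Y).symm : CompleteLatticeHom (Point Y) (Carrier Y)).comp
    ((Point.map φ).comp (carrierIso X : CompleteLatticeHom (Carrier X) (Point X)))

theorem carrierMap_apply {X Y : ProFinModAlg.{u}} (φ : X ⟶ Y) (a : Carrier X) :
    carrierMap φ a = (carrierIso Y).symm (Point.map φ (carrierIso X a)) :=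
  rfl

/-- The forgetful functor `Pro-MA_f ⥤ CABA`: it sends a profinite modal algebra `X` to its
underlying Boolean algebra, that is, to the limit of the underlying Boolean algebras of the finite
modal algebras `A`, taken over all pairs `(A, x)` with `x` a morphism from `X` to `A`. -/
noncomputable def toCABA : ProFinModAlg.{u} ⥤ CABA.{u} where
  obj X := CABA.of (Carrier X)
  map φ := ⟨carrierMap φ⟩
  map_id X := by
    refine CABA.Hom.ext (CompleteLatticeHom.ext fun a => ?_)
    change carrierMap (𝟙 X) a = a
    rw [carrierMap_apply, Point.map_id]
    exact (carrierIso X).symm_apply_apply a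
  map_comp {X Y Z} φ ψ := by
    refine CABA.Hom.ext (CompleteLatticeHom.ext fun a => ?_)
    change carrierMap (φ ≫ ψ) a = carrierMap ψ (carrierMap φ a)
    rw [carrierMap_apply, carrierMap_apply, carrierMap_apply, Point.map_comp,
      OrderIso.apply_symm_apply]
    rfl

/-- The forgetful functor `Pro-MA_f ⥤ Set`, sending a profinite modal algebra to its underlying
set. -/
noncomputable def toType : ProFinModAlg.{u} ⥤ Type u :=
  toCABA.{u} ⋙ forget CABA.{u}

end ProFinModAlg

-- Finite modal algebras are dual to finite Kripke frames with bounded morphisms: the points are the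
-- atoms, and `a` sees `b` when `a ≤ dia b`. Passing to filtered colimits, profinite modal algebras
-- are dual to frames in which each point reaches only finitely many points. Such a frame is the
-- directed union of its finite generated subframes, and finite frames are compact with respect to
-- filtered colimits (`isColimitPresheafCocone`); this gives the equivalence `toInd`. Under it the
-- forgetful functor becomes the powerset functor (`powersetIso`), so it suffices to verify the
-- hypotheses of the reflexive monadicity theorem for `powerset` and for its composite with the
-- forgetful functor to sets.
--
-- Left adjoints: complete homomorphisms from `B` to `Set W` are functions from `W` to the atoms of
-- `B`, and functions from `S` to `Set W` are functions from `W` to `Set S`. Both adjoints therefore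
-- come from the cofree frame on a set of colours (`cofreeEquiv`), made of pointed finite coloured
-- frames modulo bisimilarity. Local finiteness lets the cone of a point serve as such a frame, and
-- the use of `Fin n` as set of points keeps the construction small.
--
-- Conservativity: a bounded morphism is bijective, hence invertible, as soon as taking preimages
-- along it is bijective.
--
-- Reflexive coequalizers: dually, a coreflexive pair of bounded morphisms is equalized by a
-- generated subframe (`isUp_eqLocus`). The Beck-Chevalley identity `preimage_image_eqLocus` shows
-- that direct images split the resulting fork of powersets, so it is a coequalizer of sets and also
-- of complete atomic Boolean algebras.

universe v

/-! ### Locally finite Kripke frames -/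

/-- A Kripke frame in which only finitely many points can be reached from any given point. -/
structure LocFinFrame where
  /-- The set of points. -/
  carrier : Type u
  /-- The accessibility relation. -/
  rel : carrier → carrier → Prop
  finite_cone : ∀ w, {v | Relation.ReflTransGen rel w v}.Finite

namespace LocFinFrame

instance : CoeSort LocFinFrame.{u} (Type u) := ⟨carrier⟩

/-- Bounded morphisms of Kripke frames. -/
@[ext]
structure Hom (W V : LocFinFrame.{u}) where
  /-- The underlying map. -/
  toFun : W → V
  forth : ∀ {a b}, W.rel a b → V.rel (toFun a) (toFun b)
  back : ∀ {a c}, V.rel (toFun a) c → ∃ b, W.rel a b ∧ toFun b = c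

instance : Category.{u} LocFinFrame.{u} where
  Hom := Hom
  id W := ⟨id, fun h => h, fun h => ⟨_, h, rfl⟩⟩
  comp f g := ⟨g.toFun ∘ f.toFun, fun h => g.forth (f.forth h), fun h => by
    obtain ⟨b, hb, rfl⟩ := g.back h
    obtain ⟨a, ha, rfl⟩ := f.back hb
    exact ⟨a, ha, rfl⟩⟩

variable {W V U : LocFinFrame.{u}}

@[ext]
theorem hom_ext {f g : W ⟶ V} (h : ∀ w, f.toFun w = g.toFun w) : f = g :=
  Hom.ext (funext h)

@[simp]
theorem id_toFun (w : W) : Hom.toFun (𝟙 W) w = w := rfl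

@[simp]
theorem comp_toFun (f : W ⟶ V) (g : V ⟶ U) (w : W) : (f ≫ g).toFun w = g.toFun (f.toFun w) := rfl

theorem congr_toFun {f g : W ⟶ V} (h : f = g) (w : W) : f.toFun w = g.toFun w := by rw [h]

/-- The back condition for paths. -/
theorem exists_reflTransGen_of_back {α β : Type*} {r : α → α → Prop} {s : β → β → Prop} {f : α → β}
    (back : ∀ {a c}, s (f a) c → ∃ b, r a b ∧ f b = c) {a : α} {c : β}
    (h : Relation.ReflTransGen s (f a) c) : ∃ b, Relation.ReflTransGen r a b ∧ f b = c := by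
  induction h with
  | refl => exact ⟨a, .refl, rfl⟩
  | tail _ h ih =>
    obtain ⟨b, hb, rfl⟩ := ih
    obtain ⟨d, hd, rfl⟩ := back h
    exact ⟨d, hb.tail hd, rfl⟩

/-- The isomorphism of frames given by a bijective bounded morphism. -/
noncomputable def isoOfBijective (f : W ⟶ V) (hf : Function.Bijective f.toFun) : W ≅ V where
  hom := f
  inv :=
    { toFun := (Equiv.ofBijective _ hf).symm
      forth := fun {a b} h => by
        obtain ⟨a, rfl⟩ := hf.2 a
        obtain ⟨b', h', rfl⟩ := f.back h
        rwa [Equiv.ofBijective_symm_apply_apply, Equiv.ofBijective_symm_apply_apply]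
      back := fun {a c} h => by
        obtain ⟨a, rfl⟩ := hf.2 a
        rw [Equiv.ofBijective_symm_apply_apply] at h
        exact ⟨f.toFun c, f.forth h, Equiv.ofBijective_symm_apply_apply _ _ _⟩ }
  hom_inv_id := hom_ext fun w => Equiv.ofBijective_symm_apply_apply _ _ _
  inv_hom_id := hom_ext fun w => Equiv.ofBijective_apply_symm_apply _ _ _

theorem isIso_of_bijective (f : W ⟶ V) (hf : Function.Bijective f.toFun) : IsIso f :=
  (isoOfBijective f hf).isIso_hom

/-! #### Generated subframes -/

/-- The subframe on an upward closed set of points. -/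
def sub (W : LocFinFrame.{u}) (S : Set W) : LocFinFrame.{u} where
  carrier := S
  rel a b := W.rel a b
  finite_cone w := by
    refine ((W.finite_cone w).preimage Subtype.val_injective.injOn).subset fun v hv => ?_
    exact Relation.ReflTransGen.lift (p := W.rel) (Subtype.val : S → W) (fun _ _ h => h) _ _ hv

/-- A set of points is upward closed. -/
def IsUp (S : Set W) : Prop := ∀ ⦃a b⦄, a ∈ S → W.rel a b → b ∈ S

theorem isUp_range (f : W ⟶ V) : IsUp (Set.range f.toFun) := by
  rintro _ b ⟨a, rfl⟩ h
  obtain ⟨c, -, rfl⟩ := f.back h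
  exact ⟨c, rfl⟩

theorem IsUp.union {S T : Set W} (hS : IsUp S) (hT : IsUp T) : IsUp (S ∪ T) :=
  fun _ _ ha h => ha.imp (fun ha => hS ha h) (fun ha => hT ha h)

theorem isUp_cone (w : W) : IsUp {v | Relation.ReflTransGen W.rel w v} :=
  fun _ _ ha h => Relation.ReflTransGen.tail ha h

/-- The inclusion of a generated subframe. -/
def incl {S : Set W} (hS : IsUp S) : W.sub S ⟶ W where
  toFun := Subtype.val
  forth h := h
  back {a c} h := ⟨⟨c, hS a.2 h⟩, h, rfl⟩

/-- Factorisation through a generated subframe. -/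
def codRestrict (S : Set V) (f : W ⟶ V) (hf : ∀ w, f.toFun w ∈ S) : W ⟶ V.sub S where
  toFun w := ⟨f.toFun w, hf w⟩
  forth h := f.forth h
  back {a c} h := by
    obtain ⟨b, hb, h⟩ := f.back h
    exact ⟨b, hb, Subtype.ext h⟩

/-- The inclusion between two generated subframes. -/
def inclusion {S T : Set W} (hS : IsUp S) (h : S ⊆ T) : W.sub S ⟶ W.sub T :=
  codRestrict T (incl hS) fun w => h w.2

/-! #### Cofree frames -/

/-- The finite Kripke frames with `n` points, coloured by `K` and with a distinguished point. -/
structure PointedFrame (K : Type u) : Type u where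
  /-- The number of points. -/
  n : ℕ
  /-- The accessibility relation. -/
  rel : Fin n → Fin n → Prop
  /-- The colouring. -/
  color : Fin n → K
  /-- The distinguished point. -/
  pt : Fin n

/-! ### Bisimilarity of pointed coloured frames. -/

namespace PointedFrame

variable {K : Type u}

/-- Accessibility of pointed frames: the distinguished point moves along the relation. -/
inductive Step : PointedFrame K → PointedFrame K → Prop
  | mk {n : ℕ} {r : Fin n → Fin n → Prop} (c : Fin n → K) {x y : Fin n} (h : r x y) :
    Step ⟨n, r, c, x⟩ ⟨n, r, c, y⟩

theorem step_iff {z z' : PointedFrame K} :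
    Step z z' ↔ ∃ y, z.rel z.pt y ∧ z' = ⟨z.n, z.rel, z.color, y⟩ := by
  constructor
  · rintro ⟨c, h⟩
    exact ⟨_, h, rfl⟩
  · rintro ⟨y, h, rfl⟩
    exact .mk _ h

/-- A step changes only the distinguished point, so at most `z.n` pointed frames are reachable. -/
theorem finite_cone (z : PointedFrame K) : {z' | Relation.ReflTransGen Step z z'}.Finite := by
  refine (Set.finite_range fun y : Fin z.n => (⟨z.n, z.rel, z.color, y⟩ : PointedFrame K)).subset ?_
  intro z' h
  induction (h : Relation.ReflTransGen Step z z') with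
  | refl => exact ⟨z.pt, rfl⟩
  | tail _ h₂ ih =>
    obtain ⟨y, rfl⟩ := ih
    obtain ⟨y', -, rfl⟩ := step_iff.1 h₂
    exact ⟨y', rfl⟩

/-- The colour of the distinguished point. -/
def col (z : PointedFrame K) : K := z.color z.pt

/-- Bisimulations. -/
structure IsBisim (B : PointedFrame K → PointedFrame K → Prop) : Prop where
  col_eq : ∀ {z z'}, B z z' → z.col = z'.col
  forth : ∀ {z z' y}, B z z' → Step z y → ∃ y', Step z' y' ∧ B y y'
  back : ∀ {z z' y'}, B z z' → Step z' y' → ∃ y, Step z y ∧ B y y'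

/-- Bisimilarity. -/
def setoid (K : Type u) : Setoid (PointedFrame K) where
  r z z' := ∃ B, IsBisim B ∧ B z z'
  iseqv :=
    { refl := fun z => ⟨Eq, ⟨fun h => by rw [h], by rintro z _ y rfl h; exact ⟨y, h, rfl⟩,
        by rintro z _ y rfl h; exact ⟨y, h, rfl⟩⟩, rfl⟩
      symm := by
        rintro z z' ⟨B, hB, h⟩
        exact ⟨fun a b => B b a, ⟨fun h => (hB.col_eq h).symm, hB.back, hB.forth⟩, h⟩
      trans := by
        rintro z z' z'' ⟨B, hB, h⟩ ⟨B', hB', h'⟩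
        refine ⟨fun a c => ∃ b, B a b ∧ B' b c, ⟨?_, ?_, ?_⟩, z', h, h'⟩
        · rintro a c ⟨b, h, h'⟩
          exact (hB.col_eq h).trans (hB'.col_eq h')
        · rintro a c d ⟨b, h, h'⟩ hd
          obtain ⟨e, he, hde⟩ := hB.forth h hd
          obtain ⟨k, hk, hek⟩ := hB'.forth h' he
          exact ⟨k, hk, e, hde, hek⟩
        · rintro a c d ⟨b, h, h'⟩ hd
          obtain ⟨e, he, hde⟩ := hB'.back h' hd
          obtain ⟨k, hk, hek⟩ := hB.back h he
          exact ⟨k, hk, e, hek, hde⟩ }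

/-- The bisimilarity class of a pointed frame. -/
def cls (z : PointedFrame K) : Quotient (setoid K) := Quotient.mk (setoid K) z

/-- A step between classes is witnessed by some representatives; bisimilarity transports it so that
it starts at the given `z`. -/
theorem back_cls {z : PointedFrame K} {q : Quotient (setoid K)}
    (h : ∃ y y', cls y = cls z ∧ cls y' = q ∧ Step y y') : ∃ y, Step z y ∧ cls y = q := by
  obtain ⟨y, y', hy, rfl, h⟩ := h
  obtain ⟨B, hB, hzy⟩ := Quotient.exact hy
  obtain ⟨z', hz', hB'⟩ := hB.forth hzy h
  exact ⟨z', hz', Quotient.sound ((setoid K).symm ⟨B, hB, hB'⟩)⟩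

/-- A coloured frame `W` realises a pointed frame at `w`. -/
def Realizes (W : LocFinFrame.{u}) (c : W → K) (z : PointedFrame K) (w : W) : Prop :=
  ∃ f : Fin z.n → W, (∀ {a b}, z.rel a b → W.rel (f a) (f b)) ∧
    (∀ {a v}, W.rel (f a) v → ∃ b, z.rel a b ∧ f b = v) ∧ (∀ a, c (f a) = z.color a) ∧ f z.pt = w

namespace Realizes

variable {W : LocFinFrame.{u}} {c : W → K}

/-- The cone of `w` is finite and upward closed, so once numbered by `Fin n` it is itself the
required pointed frame. -/
theorem exists_realizes (c : W → K) (w : W) : ∃ z, Realizes W c z w := by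
  have := (W.finite_cone w).to_subtype
  obtain ⟨n, ⟨e⟩⟩ := Finite.exists_equiv_fin {v | Relation.ReflTransGen W.rel w v}
  refine ⟨⟨n, fun a b => W.rel (e.symm a) (e.symm b), fun a => c (e.symm a), e ⟨w, .refl⟩⟩,
    fun a => e.symm a, fun h => h, fun {a v} h => ?_, fun _ => rfl, ?_⟩
  · exact ⟨e ⟨v, isUp_cone w (e.symm a).2 h⟩, by simpa using h, by simp⟩
  · simp

theorem col_eq {z : PointedFrame K} {w : W} (h : Realizes W c z w) : z.col = c w := by
  obtain ⟨f, -, -, h, rfl⟩ := h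
  exact (h _).symm

theorem forth {z y : PointedFrame K} {w : W} (h : Realizes W c z w) (hy : Step z y) :
    ∃ v, W.rel w v ∧ Realizes W c y v := by
  obtain ⟨f, h₁, h₂, h₃, rfl⟩ := h
  obtain ⟨y, hr, rfl⟩ := step_iff.1 hy
  exact ⟨f y, h₁ hr, f, h₁, h₂, h₃, rfl⟩

theorem back {z : PointedFrame K} {w v : W} (h : Realizes W c z w) (hv : W.rel w v) :
    ∃ y, Step z y ∧ Realizes W c y v := by
  obtain ⟨f, h₁, h₂, h₃, rfl⟩ := h
  obtain ⟨y, hy, rfl⟩ := h₂ hv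
  exact ⟨_, step_iff.2 ⟨y, hy, rfl⟩, f, h₁, h₂, h₃, rfl⟩

/-- Realising a common point of `W` is a bisimulation. Hence the choice of realisation in `toCofree`
does not matter. -/
theorem cls_eq {z z' : PointedFrame K} {w : W} (h : Realizes W c z w) (h' : Realizes W c z' w) :
    cls z = cls z' := by
  refine Quotient.sound ⟨fun z z' => ∃ w, Realizes W c z w ∧ Realizes W c z' w,
    ⟨?_, ?_, ?_⟩, w, h, h'⟩
  · rintro z z' ⟨w, h, h'⟩
    exact h.col_eq.trans h'.col_eq.symm
  · rintro z z' y ⟨w, h, h'⟩ hy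
    obtain ⟨v, hv, hyv⟩ := h.forth hy
    obtain ⟨y', hy', hyv'⟩ := h'.back hv
    exact ⟨y', hy', v, hyv, hyv'⟩
  · rintro z z' y ⟨w, h, h'⟩ hy
    obtain ⟨v, hv, hyv⟩ := h'.forth hy
    obtain ⟨y', hy', hyv'⟩ := h.back hv
    exact ⟨y', hy', v, hyv', hyv⟩

end Realizes

end PointedFrame

open PointedFrame

/-- The cofree locally finite frame on a set of colours: pointed finite coloured frames up to
bisimilarity. -/
def cofree (K : Type u) : LocFinFrame.{u} where
  carrier := Quotient (setoid K)
  rel q q' := ∃ z z', cls z = q ∧ cls z' = q' ∧ Step z z'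
  finite_cone q := by
    induction q using Quotient.inductionOn with | h z => ?_
    refine (z.finite_cone.image cls).subset fun q h => ?_
    exact exists_reflTransGen_of_back back_cls h

/-- The universal colouring of the cofree frame. -/
def cofreeColor (K : Type u) : cofree K → K :=
  Quotient.lift col fun _ _ ⟨_, hB, h⟩ => hB.col_eq h

/-- The bounded morphism into the cofree frame induced by a colouring. -/
noncomputable def toCofree {K : Type u} (c : W → K) : W ⟶ cofree K where
  toFun w := cls (Realizes.exists_realizes c w).choose
  forth {w v} h := by
    obtain ⟨y, hy, hyv⟩ := (Realizes.exists_realizes c w).choose_spec.back h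
    exact ⟨_, y, rfl, hyv.cls_eq (Realizes.exists_realizes c v).choose_spec, hy⟩
  back {w q} h := by
    obtain ⟨y, hy, rfl⟩ := back_cls h
    obtain ⟨v, hv, hyv⟩ := (Realizes.exists_realizes c w).choose_spec.forth hy
    exact ⟨v, hv, (Realizes.exists_realizes c v).choose_spec.cls_eq hyv⟩

theorem cofreeColor_toCofree {K : Type u} (c : W → K) (w : W) :
    cofreeColor K ((toCofree c).toFun w) = c w :=
  (Realizes.exists_realizes c w).choose_spec.col_eq

/-- Representing `f w` and `g w` for a common point `w` is a bisimulation: steps are lifted to `W`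
by the back condition of one morphism and sent forward by the other. -/
theorem cofree_hom_ext {K : Type u} {f g : W ⟶ cofree K}
    (h : ∀ w, cofreeColor K (f.toFun w) = cofreeColor K (g.toFun w)) : f = g := by
  refine hom_ext fun w => ?_
  obtain ⟨z, hz⟩ := Quotient.exists_rep (f.toFun w)
  obtain ⟨z', hz'⟩ := Quotient.exists_rep (g.toFun w)
  rw [← hz, ← hz']
  refine Quotient.sound ⟨fun z z' => ∃ w, cls z = f.toFun w ∧ cls z' = g.toFun w,
    ⟨?_, ?_, ?_⟩, w, hz, hz'⟩
  · rintro z z' ⟨w, hz, hz'⟩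
    have := h w
    rwa [← hz, ← hz'] at this
  · rintro z z' y ⟨w, hz, hz'⟩ hy
    obtain ⟨v, hv, hyv⟩ := f.back (a := w) (c := cls y) ⟨z, y, hz, rfl, hy⟩
    have := g.forth hv
    rw [← hz'] at this
    obtain ⟨y', hy', hyv'⟩ := back_cls this
    exact ⟨y', hy', v, hyv.symm, hyv'⟩
  · rintro z z' y ⟨w, hz, hz'⟩ hy
    obtain ⟨v, hv, hyv⟩ := g.back (a := w) (c := cls y) ⟨z', y, hz', rfl, hy⟩
    have := f.forth hv
    rw [← hz] at this
    obtain ⟨y', hy', hyv'⟩ := back_cls this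
    exact ⟨y', hy', v, hyv', hyv.symm⟩

/-- The universal property of the cofree frame. -/
noncomputable def cofreeEquiv (W : LocFinFrame.{u}) (K : Type u) :
    (W ⟶ cofree K) ≃ (W → K) where
  toFun f w := cofreeColor K (f.toFun w)
  invFun := toCofree
  left_inv _ := cofree_hom_ext (cofreeColor_toCofree _)
  right_inv c := funext (cofreeColor_toCofree c)

/-! #### Equalizers of coreflexive pairs -/

/-- The equalizer of a coreflexive pair is a generated subframe. -/
theorem isUp_eqLocus {f g : W ⟶ V} {r : V ⟶ W} (hf : f ≫ r = 𝟙 W) (hg : g ≫ r = 𝟙 W) :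
    IsUp {w | f.toFun w = g.toFun w} := by
  intro w v hw h
  have h' := f.forth h
  rw [show f.toFun w = g.toFun w from hw] at h'
  obtain ⟨v', -, hv'⟩ := g.back h'
  -- The common retraction `r` turns `g v' = f v` into `v' = v`.
  have h₁ := congr_toFun hf v
  have h₂ := congr_toFun hg v'
  rw [comp_toFun, id_toFun] at h₁ h₂
  rw [hv', h₁] at h₂
  subst h₂
  exact hv'.symm

end LocFinFrame

/-! ### Atoms -/

/-- A completely prime filter of a complete atomic Boolean algebra is generated by an atom. -/
theorem exists_isAtom_forall_iff_le {A : Type*} [CompleteAtomicBooleanAlgebra A] (P : A → Prop)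
    (hmono : ∀ {x y}, x ≤ y → P x → P y) (hinf : ∀ {x y}, P x → P y → P (x ⊓ y)) (hbot : ¬ P ⊥)
    (htop : P ⊤) (hsup : ∀ s : Set A, P (sSup s) → ∃ x ∈ s, P x) :
    ∃ a, IsAtom a ∧ ∀ x, P x ↔ a ≤ x := by
  -- Since `⊤` is the join of the atoms, `P` holds at some atom `a`. If `P x` held with `a` not
  -- below `x`, then `P` would hold at `a ⊓ x = ⊥`.
  rw [← sSup_atoms_eq_top] at htop
  obtain ⟨a, ha, hPa⟩ := hsup _ htop
  have ha : IsAtom a := ha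
  refine ⟨a, ha, fun x => ⟨fun h => ?_, fun h => hmono h hPa⟩⟩
  by_contra hx
  exact hbot ((ha.not_le_iff_disjoint.1 hx).eq_bot ▸ hinf hPa h)

/-! ### Split coequalizers in `CABA`. -/

namespace CABA

variable {A B : CABA.{u}}

@[simp]
theorem comp_apply {C : CABA.{u}} (f : A ⟶ B) (g : B ⟶ C) (a : A) : (f ≫ g) a = g (f a) := rfl

theorem hom_ext {f g : A ⟶ B} (h : ∀ a : A, f a = g a) : f = g :=
  Hom.ext (CompleteLatticeHom.ext h)

/-- Split coequalizers of underlying sets are coequalizers of complete atomic Boolean algebras. -/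
noncomputable def isColimitOfSplit {X Y Z : CABA.{u}} {f g : X ⟶ Y} {π : Y ⟶ Z}
    (w : f ≫ π = g ≫ π) (s : Z → Y) (t : Y → X) (hs : ∀ z, π (s z) = z) (ht : ∀ y, g (t y) = y)
    (hst : ∀ y, f (t y) = s (π y)) : IsColimit (Cofork.ofπ π w) := by
  have key (c : Cofork f g) (y : Y) : c.π (s (π y)) = c.π y := by
    have := congr($(c.condition) (t y))
    rwa [comp_apply, comp_apply, ht, hst] at this
  have hS (S : Set Z) : π '' (s '' S) = S := by
    rw [Set.image_image]
    simp [hs]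
  refine Cofork.IsColimit.mk _ (fun c => ⟨⟨⟨fun z => c.π (s z), fun S => ?_⟩, fun S => ?_⟩⟩)
    (fun c => ?_) fun c m hm => ?_
  -- The section `s` need not preserve meets or joins, so they are computed upstairs in `Y`, where
  -- `π` and `c.π` preserve them, and `key` removes `s`.
  · have h : sInf S = π (sInf (s '' S)) := by rw [map_sInf (ConcreteCategory.hom π), hS]
    rw [h, key, map_sInf (ConcreteCategory.hom c.π), Set.image_image]
    rfl
  · have h : sSup S = π (sSup (s '' S)) := by rw [map_sSup (ConcreteCategory.hom π), hS]
    change c.π (s (sSup S)) = sSup ((fun z => c.π (s z)) '' S)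
    rw [h, key, map_sSup (ConcreteCategory.hom c.π), Set.image_image]
  · exact hom_ext (key c)
  · refine hom_ext fun z => ?_
    have := congr($hm (s z))
    exact (congrArg _ (hs z)).symm.trans this

end CABA

/-! ### The powerset functor: adjoints, conservativity, reflexive coequalizers. -/

namespace LocFinFrame

/-- The complex algebra of a frame, without its operator. -/
def powerset : LocFinFrame.{u}ᵒᵖ ⥤ CABA.{u} where
  obj W := CABA.of (Set W.unop)
  map f := ⟨CompleteLatticeHom.setPreimage f.unop.toFun⟩

/-- The elements whose image contains `w` form a completely prime filter. -/
theorem exists_isAtom_of_hom (B : CABA.{u}) (W : LocFinFrame.{u}) (f : CompleteLatticeHom B (Set W))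
    (w : W) : ∃ b : B, IsAtom b ∧ ∀ x, w ∈ f x ↔ b ≤ x :=
  exists_isAtom_forall_iff_le (fun x => w ∈ f x) (fun h hx => OrderHomClass.mono f h hx)
    (fun hx hy => by rw [map_inf]; exact ⟨hx, hy⟩) (by rw [map_bot]; exact id)
    (by rw [map_top]; trivial) (fun s hs => by
      rw [map_sSup] at hs
      obtain ⟨_, ⟨x, hx, rfl⟩, hw⟩ := hs
      exact ⟨x, hx, hw⟩)

/-- Complete homomorphisms into a powerset algebra are families of atoms. -/
noncomputable def completeHomEquiv (B : CABA.{u}) (W : LocFinFrame.{u}) :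
    (W → {b : B // IsAtom b}) ≃ CompleteLatticeHom B (Set W) where
  toFun c :=
    { toFun := fun x => {w | (c w).1 ≤ x}
      map_sSup' := fun S => by
        ext w
        simpa using (c w).2.le_sSup
      map_sInf' := fun S => by
        ext w
        simp }
  invFun f w := ⟨_, (exists_isAtom_of_hom B W f w).choose_spec.1⟩
  left_inv c := by
    funext w
    exact Subtype.ext (eq_of_forall_ge_iff fun x =>
      ((exists_isAtom_of_hom B W _ w).choose_spec.2 x).symm)
  right_inv f := by
    refine CompleteLatticeHom.ext fun x => ?_
    ext w
    exact ((exists_isAtom_of_hom B W f w).choose_spec.2 x).symm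

/-- Morphisms of `CABA` into a powerset algebra are families of atoms. -/
noncomputable def homPowersetEquiv (B : CABA.{u}) (W : LocFinFrame.{u}ᵒᵖ) :
    (W.unop → {b : B // IsAtom b}) ≃ (B ⟶ powerset.obj W) :=
  (completeHomEquiv B W.unop).trans ⟨fun f => ⟨f⟩, fun f => f.hom', fun _ => rfl, fun _ => rfl⟩

/-- A morphism from `B` to a powerset is a colouring by atoms of `B`, hence a bounded morphism into
the cofree frame on these atoms. -/
instance : powerset.{u}.IsRightAdjoint :=
  (Adjunction.adjunctionOfEquivLeft (F_obj := fun B : CABA.{u} => op (cofree {b : B // IsAtom b}))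
    (fun B W => (opEquiv _ _).trans ((cofreeEquiv W.unop _).trans (homPowersetEquiv B W)))
    (fun _ _ _ _ _ => rfl)).isRightAdjoint

/-- A function from `S` to the subsets of `W` transposes to a colouring of `W` by subsets of `S`. -/
instance : (powerset.{u} ⋙ forget CABA.{u}).IsRightAdjoint :=
  (Adjunction.adjunctionOfEquivLeft (F_obj := fun S => op (cofree (Set S)))
    (fun _ W => (opEquiv _ _).trans ((cofreeEquiv W.unop _).trans
      { toFun := fun c => TypeCat.ofHom fun s => {w | s ∈ c w}
        invFun := fun f w => {s | w ∈ (show Set W.unop from f s)}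
        left_inv := fun _ => rfl
        right_inv := fun _ => rfl }))
    (fun _ _ _ _ _ => rfl)).isRightAdjoint

instance : (powerset.{u} ⋙ forget CABA.{u}).ReflectsIsomorphisms where
  reflects {W V} f _ := by
    have hf : Function.Bijective (Set.preimage f.unop.toFun) :=
      (isIso_iff_bijective ((powerset ⋙ forget CABA).map f)).1 inferInstance
    have : IsIso f.unop := isIso_of_bijective _
      ⟨Set.preimage_surjective.1 hf.2, Set.preimage_injective.1 hf.1⟩
    exact (isIso_unop_iff f).1 this

instance : powerset.{u}.ReflectsIsomorphisms :=
  reflectsIsomorphisms_of_comp powerset (forget CABA.{u})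

theorem preimage_image_of_retraction {W V : LocFinFrame.{u}} {g : W ⟶ V} {r : V ⟶ W}
    (h : g ≫ r = 𝟙 W) (T : Set W) : g.toFun ⁻¹' (g.toFun '' T) = T :=
  Set.preimage_image_eq _ (Function.LeftInverse.injective (congr_toFun h))

section Coequalizer

variable {X Y : LocFinFrame.{u}ᵒᵖ} (f g : X ⟶ Y) [IsReflexivePair f g]

theorem isUp_eqLocus_unop : IsUp {w | f.unop.toFun w = g.unop.toFun w} :=
  isUp_eqLocus (r := (commonSection f g).unop)
    (congrArg Quiver.Hom.unop (section_comp_left f g))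
    (congrArg Quiver.Hom.unop (section_comp_right f g))

theorem comp_eqLocus : f ≫ (incl (isUp_eqLocus_unop f g)).op =
    g ≫ (incl (isUp_eqLocus_unop f g)).op :=
  Quiver.Hom.unop_inj (hom_ext fun w => w.2)

/-- The coequalizer of a reflexive pair in the opposite of the category of frames. -/
def isColimitEqLocus : IsColimit (Cofork.ofπ _ (comp_eqLocus f g)) :=
  Cofork.IsColimit.mk _
    (fun s => (codRestrict _ s.π.unop
      (congr_toFun (congrArg Quiver.Hom.unop s.condition))).op)
    (fun _ => rfl)
    (fun _ _ hm => Quiver.Hom.unop_inj (hom_ext fun w => Subtype.ext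
      (congr_toFun (congrArg Quiver.Hom.unop hm) w)))

/-- Beck-Chevalley: if `g v = f w`, the common retraction gives `v = w`, so this point lies in the
equalizer. -/
theorem preimage_image_eqLocus (T : Set Y.unop) :
    f.unop.toFun ⁻¹' (g.unop.toFun '' T) =
      Subtype.val '' ((incl (isUp_eqLocus_unop f g)).toFun ⁻¹' T) := by
  have hf := congr_toFun (congrArg Quiver.Hom.unop (section_comp_left f g))
  have hg := congr_toFun (congrArg Quiver.Hom.unop (section_comp_right f g))
  ext w
  constructor
  · rintro ⟨v, hv, h⟩
    have : v = w := by
      rw [← show _ = v from hg v, ← show _ = w from hf w]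
      exact congrArg (commonSection f g).unop.toFun h
    subst this
    exact ⟨⟨v, h.symm⟩, hv, rfl⟩
  · rintro ⟨v, hv, rfl⟩
    exact ⟨v, hv, v.2.symm⟩

theorem preimage_incl_image {W : LocFinFrame.{u}} {S : Set W} (hS : IsUp S) (T : Set S) :
    (incl hS).toFun ⁻¹' (Subtype.val '' T) = T :=
  Set.preimage_image_eq _ Subtype.val_injective

instance : HasReflexiveCoequalizers LocFinFrame.{u}ᵒᵖ where
  has_coeq _ _ f g _ := ⟨_, isColimitEqLocus f g⟩

/-- The splittings are direct images, which need not preserve meets; hence the fork splits only on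
underlying sets, and `CABA.isColimitOfSplit` is needed. -/
instance : Monad.PreservesColimitOfIsReflexivePair powerset.{u} where
  out _ _ f g _ := preservesColimit_of_preserves_colimit_cocone (isColimitEqLocus f g)
    ((isColimitMapCoconeCoforkEquiv _ _).symm
      (CABA.isColimitOfSplit _ (fun T => Subtype.val '' T) (fun T => g.unop.toFun '' T)
        (preimage_incl_image (isUp_eqLocus_unop f g)) (preimage_image_of_retraction
          (congrArg Quiver.Hom.unop (section_comp_right f g)))
        (preimage_image_eqLocus f g)))

instance : Monad.PreservesColimitOfIsReflexivePair (powerset.{u} ⋙ forget CABA.{u}) where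
  out _ _ f g _ := preservesColimit_of_preserves_colimit_cocone (isColimitEqLocus f g)
    ((isColimitMapCoconeCoforkEquiv _ _).symm
      (IsSplitCoequalizer.isCoequalizer
        { rightSection := TypeCat.ofHom fun T => (Subtype.val '' T : Set _)
          leftSection := TypeCat.ofHom fun T => (g.unop.toFun '' T : Set _)
          condition := by
            exact congrArg (powerset ⋙ forget CABA).map (comp_eqLocus f g)
          rightSection_π := by
            refine TypeCat.Hom.ext (TypeCat.Fun.ext (funext fun T => ?_))
            exact preimage_incl_image (isUp_eqLocus_unop f g) T
          leftSection_bottom := by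
            refine TypeCat.Hom.ext (TypeCat.Fun.ext (funext fun T => ?_))
            exact preimage_image_of_retraction
              (congrArg Quiver.Hom.unop (section_comp_right f g)) T
          leftSection_top := by
            refine TypeCat.Hom.ext (TypeCat.Fun.ext (funext fun T => ?_))
            exact preimage_image_eqLocus f g T }))

end Coequalizer

end LocFinFrame

/-! ### Duality between finite modal algebras and finite frames -/

namespace FinModAlg

open ModalAlgebra

theorem dia_sSup {A : FinModAlg.{u}} (s : Set A.obj) : dia (sSup s) = ⨆ a ∈ s, dia a := by
  have : Finite A.obj := A.property
  induction s, s.toFinite using Set.Finite.induction_on with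
  | empty =>
    rw [sSup_empty, iSup_emptyset]
    exact dia_bot
  | insert _ _ ih =>
    rw [sSup_insert, iSup_insert, ← ih]
    exact dia_sup _ _

theorem dia_mono {A : FinModAlg.{u}} {x y : A.obj} (h : x ≤ y) : dia x ≤ dia y := by
  have := dia_sup x y
  rw [show x ⊔ y = y from sup_eq_right.2 h] at this
  exact sup_eq_right.1 this.symm

theorem map_mono {A B : FinModAlg.{u}} (f : A ⟶ B) {x y : A.obj} (h : x ≤ y) :
    f.hom x ≤ f.hom y := by
  have : f.hom (x ⊔ y) = f.hom x ⊔ f.hom y := map_sup (ConcreteCategory.hom f.hom) x y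
  rw [show x ⊔ y = y from sup_eq_right.2 h] at this
  exact sup_eq_right.1 this.symm

theorem map_dia {A B : FinModAlg.{u}} (f : A ⟶ B) (x : A.obj) :
    f.hom (dia x) = dia (f.hom x) :=
  ModalHom.map_dia f.hom.hom' x

/-- The set of atoms of a finite modal algebra. -/
abbrev Atom (A : FinModAlg.{u}) : Type u := {a : A.obj // IsAtom a}

/-- The element `x` is the join of the atoms below it, `dia` preserves this join, and the atom `a`
is join-prime. -/
theorem le_dia_iff {A : FinModAlg.{u}} (a : Atom A) (x : A.obj) :
    a.1 ≤ dia x ↔ ∃ b : Atom A, b.1 ≤ x ∧ a.1 ≤ dia b.1 := by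
  constructor
  · intro h
    rw [eq_sSup_atoms x |>.choose_spec.1, dia_sSup] at h
    obtain ⟨b, hb⟩ := a.2.le_iSup.1 h
    obtain ⟨hbs, hb⟩ := a.2.le_iSup.1 hb
    have hs := (eq_sSup_atoms x).choose_spec
    exact ⟨⟨b, hs.2 b hbs⟩, (le_sSup hbs).trans hs.1.ge, hb⟩
  · rintro ⟨b, hb, h⟩
    exact h.trans (dia_mono hb)

theorem exists_isAtom {A B : FinModAlg.{u}} (f : A ⟶ B) (b : Atom B) :
    ∃ a : A.obj, IsAtom a ∧ ∀ x, b.1 ≤ f.hom x ↔ a ≤ x :=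
  exists_isAtom_forall_iff_le (fun x => b.1 ≤ f.hom x) (fun h hx => hx.trans (map_mono f h))
    (fun hx hy => (le_inf hx hy).trans_eq (map_inf (ConcreteCategory.hom f.hom) _ _).symm)
    (fun h => b.2.ne_bot (le_bot_iff.1 (h.trans_eq (map_bot (ConcreteCategory.hom f.hom)))))
    (le_top.trans_eq (map_top (ConcreteCategory.hom f.hom)).symm)
    (fun s hs => by
      rw [map_sSup] at hs
      obtain ⟨x, hx⟩ := b.2.le_iSup.1 hs
      obtain ⟨hxs, hx⟩ := b.2.le_iSup.1 hx
      exact ⟨x, hxs, hx⟩)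

/-- The map on atoms which is dual to a morphism of finite modal algebras. -/
noncomputable def atomMap {A B : FinModAlg.{u}} (f : A ⟶ B) (b : Atom B) : Atom A :=
  ⟨(exists_isAtom f b).choose, (exists_isAtom f b).choose_spec.1⟩

theorem le_map_iff {A B : FinModAlg.{u}} (f : A ⟶ B) (b : Atom B) (x : A.obj) :
    b.1 ≤ f.hom x ↔ (atomMap f b).1 ≤ x :=
  (exists_isAtom f b).choose_spec.2 x

theorem Atom.ext_le {A : FinModAlg.{u}} {a b : Atom A} (h : ∀ x, a.1 ≤ x ↔ b.1 ≤ x) : a = b :=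
  Subtype.ext (eq_of_forall_ge_iff h)

theorem Atom.eq_of_le {A : FinModAlg.{u}} {a b : Atom A} (h : a.1 ≤ b.1) : a = b :=
  Subtype.ext ((b.2.le_iff_eq a.2.ne_bot).1 h)

theorem ext_atom {A : FinModAlg.{u}} {x y : A.obj} (h : ∀ a : Atom A, a.1 ≤ x ↔ a.1 ≤ y) : x = y :=
  eq_iff_atom_le_iff.2 fun a ha => h ⟨a, ha⟩

/-- The frame of atoms of a finite modal algebra. -/
def atomFrame (A : FinModAlg.{u}) : LocFinFrame.{u} where
  carrier := Atom A
  rel a b := a.1 ≤ dia b.1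
  finite_cone w := by
    have : Finite A.obj := A.property
    exact Set.toFinite _

instance (A : FinModAlg.{u}) : Finite (atomFrame A) :=
  have : Finite A.obj := A.property
  inferInstanceAs (Finite (Atom A))

/-- The functor of atoms from finite modal algebras to frames. -/
noncomputable def atoms : FinModAlg.{u}ᵒᵖ ⥤ LocFinFrame.{u} where
  obj A := atomFrame A.unop
  map {B A} f :=
    { toFun := atomMap f.unop
      forth := fun {b c} h => by
        refine (le_map_iff f.unop b _).1 ?_
        rw [map_dia]
        exact le_trans h (dia_mono ((le_map_iff f.unop c _).2 le_rfl))
      back := fun {b a} h => by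
        have h' := (le_map_iff f.unop b _).2 h
        rw [map_dia] at h'
        obtain ⟨c, hc, h⟩ := (le_dia_iff (A := B.unop) b _).1 h'
        exact ⟨c, h, Atom.eq_of_le ((le_map_iff f.unop c _).1 hc)⟩ }
  map_id A := LocFinFrame.hom_ext fun a => Atom.ext_le fun x => (le_map_iff (𝟙 A.unop) a x).symm
  map_comp f g := LocFinFrame.hom_ext fun a => Atom.ext_le fun x =>
    ((le_map_iff _ a x).symm.trans (le_map_iff f.unop a _)).trans (le_map_iff g.unop _ x)

instance (A : FinModAlg.{u}ᵒᵖ) : Finite (atoms.obj A) :=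
  inferInstanceAs (Finite (atomFrame A.unop))

theorem le_map_iff_atoms {A B : FinModAlg.{u}ᵒᵖ} (f : A ⟶ B) (a : atoms.obj A) (x : B.unop.obj) :
    a.1 ≤ f.unop.hom x ↔ ((atoms.map f).toFun a).1 ≤ x :=
  le_map_iff f.unop a x

/-- An element is determined by the atoms below it, and the dual map determines which atoms lie
below `f x`. -/
instance : atoms.{u}.Faithful where
  map_injective {_ _} f g h := by
    refine Quiver.Hom.unop_inj (ObjectProperty.hom_ext _ (ModAlg.Hom.ext (DFunLike.ext _ _
      fun x => ext_atom fun a => ?_)))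
    refine (le_map_iff_atoms f a x).trans (Iff.trans ?_ (le_map_iff_atoms g a x).symm)
    rw [h]

/-- The join of a set of atoms. -/
noncomputable def join {A : FinModAlg.{u}} (P : Atom A → Prop) : A.obj :=
  sSup (Subtype.val '' {a | P a})

theorem le_join {A : FinModAlg.{u}} {P : Atom A → Prop} {a : Atom A} : a.1 ≤ join P ↔ P a := by
  rw [join, a.2.le_sSup]
  constructor
  · rintro ⟨_, ⟨b, hb, rfl⟩, h⟩
    rwa [Atom.eq_of_le h]
  · exact fun h => ⟨_, ⟨a, h, rfl⟩, le_rfl⟩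

theorem le_sup_iff {A : FinModAlg.{u}} (a : Atom A) {x y : A.obj} :
    a.1 ≤ x ⊔ y ↔ a.1 ≤ x ∨ a.1 ≤ y := by
  have := a.2.le_sSup (s := {x, y})
  rw [sSup_pair] at this
  simpa using this

/-- The map of finite modal algebras which is dual to a map of atoms. -/
noncomputable def inverseImage {A B : FinModAlg.{u}} (φ : Atom B → Atom A) (x : A.obj) : B.obj :=
  join fun b => (φ b).1 ≤ x

theorem le_inverseImage {A B : FinModAlg.{u}} {φ : Atom B → Atom A} {x : A.obj} {b : Atom B} :
    b.1 ≤ inverseImage φ x ↔ (φ b).1 ≤ x :=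
  le_join (P := fun b => (φ b).1 ≤ x)

/-- The morphism of finite modal algebras which is dual to a bounded morphism. -/
noncomputable def ofBounded {A B : FinModAlg.{u}} (φ : atomFrame B ⟶ atomFrame A) : A ⟶ B :=
  ObjectProperty.homMk ⟨
    { toFun := inverseImage φ.toFun
      map_sup' := fun x y => ext_atom fun b => by
        refine le_inverseImage.trans ((le_sup_iff _).trans (Iff.trans ?_ (le_sup_iff _).symm))
        exact (or_congr le_inverseImage le_inverseImage).symm
      map_inf' := fun x y => ext_atom fun b =>
        le_inverseImage.trans (le_inf_iff.trans ((and_congr le_inverseImage le_inverseImage).symm.trans le_inf_iff.symm))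
      map_top' := ext_atom fun b => le_inverseImage.trans (iff_of_true le_top le_top)
      map_bot' := ext_atom fun b => le_inverseImage.trans (iff_of_false
        (fun h => (φ.toFun b).2.ne_bot (le_bot_iff.1 h)) (fun h => b.2.ne_bot (le_bot_iff.1 h)))
      map_dia' := fun x => ext_atom fun b => by
        refine le_inverseImage.trans ((le_dia_iff (φ.toFun b) x).trans (Iff.trans ?_ (le_dia_iff b _).symm))
        constructor
        · rintro ⟨a, ha, h⟩
          obtain ⟨c, hc, rfl⟩ := φ.back h
          exact ⟨c, le_inverseImage.2 ha, hc⟩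
        · rintro ⟨c, hc, h⟩
          exact ⟨φ.toFun c, le_inverseImage.1 hc, φ.forth h⟩ }⟩

/-- An atom is determined by the elements above it, so the adjunction-like condition
`le_inverseImage` recovers `φ` from `ofBounded φ`. -/
instance : atoms.{u}.Full where
  map_surjective φ := ⟨(ofBounded φ).op, LocFinFrame.hom_ext fun a => Atom.ext_le fun x =>
    (le_map_iff (ofBounded φ) a x).symm.trans le_inverseImage⟩

/-- The modal algebra of subsets of a frame. -/
@[reducible]
def complexAlgebra (W : LocFinFrame.{u}) : ModalAlgebra (Set W) where
  dia S := {w | ∃ v ∈ S, W.rel w v}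
  dia_sup S T := by
    ext w
    constructor
    · rintro ⟨v, hv | hv, h⟩
      exacts [Or.inl ⟨v, hv, h⟩, Or.inr ⟨v, hv, h⟩]
    · rintro (⟨v, hv, h⟩ | ⟨v, hv, h⟩)
      exacts [⟨v, Or.inl hv, h⟩, ⟨v, Or.inr hv, h⟩]
  dia_bot := by
    ext w
    exact iff_of_false (fun ⟨v, hv, _⟩ => hv) id

/-- The finite modal algebra of subsets of a finite frame. -/
def complex (W : LocFinFrame.{u}) [Finite W] : FinModAlg.{u} :=
  letI := complexAlgebra W
  ⟨ModAlg.of (Set W), inferInstanceAs (Finite (Set W))⟩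

theorem exists_singleton_eq {W : LocFinFrame.{u}} [Finite W] (c : atoms.obj (op (complex W))) :
    ∃ w : W, ({w} : Set W) = c.1 :=
  (Set.isAtom_iff.1 c.2).imp fun _ h => h.symm

/-- Every finite frame is the frame of atoms of its modal algebra of subsets. -/
noncomputable def complexIso (W : LocFinFrame.{u}) [Finite W] :
    W ≅ atoms.obj (op (complex W)) :=
  LocFinFrame.isoOfBijective
    { toFun := fun w => ⟨({w} : Set W), Set.isAtom_singleton w⟩
      forth := fun {a b} h => by
        rintro _ rfl
        exact ⟨b, rfl, h⟩
      back := fun {a c} h => by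
        obtain ⟨v, hv⟩ := exists_singleton_eq c
        obtain ⟨x, hx, h⟩ := h (Set.mem_singleton a)
        refine ⟨v, ?_, Subtype.ext hv⟩
        rw [← hv] at hx
        rwa [← show x = v from hx] }
    ⟨fun a b h => Set.singleton_injective (congrArg Subtype.val h), fun c =>
      (exists_singleton_eq c).imp fun _ h => Subtype.ext h⟩

end FinModAlg

/-! ### Frames as ind-objects -/

namespace LocFinFrame

open FinModAlg

/-- The presheaf of bounded morphisms from finite frames, given as frames of atoms. -/
noncomputable def presheaf : LocFinFrame.{u} ⥤ (FinModAlg.{u}ᵒᵖ)ᵒᵖ ⥤ Type u :=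
  yoneda ⋙ (Functor.whiskeringLeft _ _ _).obj atoms.op

theorem inv_injective {W V : LocFinFrame.{u}} (e : W ≅ V) : Function.Injective e.inv.toFun :=
  Function.LeftInverse.injective (g := e.hom.toFun) (congr_toFun e.inv_hom_id)

/-- A finite generated subframe as a frame of atoms. -/
theorem exists_injective_of_finite {W : LocFinFrame.{u}} {S : Set W} (hS : IsUp S)
    (hf : S.Finite) : ∃ (A : FinModAlg.{u}ᵒᵖ) (e : W.sub S ≅ atoms.obj A) (χ : atoms.obj A ⟶ W),
      e.hom ≫ χ = incl hS ∧ Function.Injective χ.toFun := by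
  have : Finite (W.sub S) := hf
  refine ⟨_, complexIso _, (complexIso (W.sub S)).inv ≫ incl hS, by simp, ?_⟩
  refine Function.Injective.comp (g := (incl hS).toFun) Subtype.val_injective ?_
  exact inv_injective _

theorem exists_atoms_point (W : LocFinFrame.{u}) (w : W) :
    ∃ (A : FinModAlg.{u}ᵒᵖ) (φ : atoms.obj A ⟶ W) (a : atoms.obj A), φ.toFun a = w := by
  obtain ⟨A, e, χ, h, -⟩ := exists_injective_of_finite (isUp_cone w) (W.finite_cone w)
  exact ⟨A, χ, e.hom.toFun ⟨w, .refl⟩, congr_toFun h _⟩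

/-- Both morphisms factor through the union of their ranges, a finite generated subframe. -/
theorem exists_common_factor {W : LocFinFrame.{u}} {A B : FinModAlg.{u}ᵒᵖ} (φ : atoms.obj A ⟶ W)
    (ψ : atoms.obj B ⟶ W) : ∃ (C : FinModAlg.{u}ᵒᵖ) (χ : atoms.obj C ⟶ W) (f : A ⟶ C) (g : B ⟶ C),
      atoms.map f ≫ χ = φ ∧ atoms.map g ≫ χ = ψ ∧ Function.Injective χ.toFun := by
  obtain ⟨C, e, χ, h, hχ⟩ := exists_injective_of_finite ((isUp_range φ).union (isUp_range ψ))
    ((Set.finite_range _).union (Set.finite_range _))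
  refine ⟨C, χ, atoms.preimage (codRestrict _ φ (fun w => Or.inl ⟨w, rfl⟩) ≫ e.hom),
    atoms.preimage (codRestrict _ ψ (fun w => Or.inr ⟨w, rfl⟩) ≫ e.hom), ?_, ?_, hχ⟩
  · rw [Functor.map_preimage, Category.assoc, h]
    rfl
  · rw [Functor.map_preimage, Category.assoc, h]
    rfl

/-- A compatible family of points or predicates on points only depends on the point of `W`. -/
theorem eq_of_compatible {W : LocFinFrame.{u}} {T : Type*}
    (t : ∀ A : FinModAlg.{u}ᵒᵖ, (atoms.obj A ⟶ W) → atoms.obj A → T)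
    (ht : ∀ {A B : FinModAlg.{u}ᵒᵖ} (f : A ⟶ B) (φ : atoms.obj B ⟶ W) (a : atoms.obj A),
      t A (atoms.map f ≫ φ) a = t B φ ((atoms.map f).toFun a))
    {A B : FinModAlg.{u}ᵒᵖ} {φ : atoms.obj A ⟶ W} {ψ : atoms.obj B ⟶ W} {a : atoms.obj A}
    {b : atoms.obj B} (h : φ.toFun a = ψ.toFun b) : t A φ a = t B ψ b := by
  obtain ⟨C, χ, f, g, rfl, rfl, hχ⟩ := exists_common_factor φ ψ
  rw [ht, ht, hχ h]

theorem hom_ext_of_atoms {W V : LocFinFrame.{u}} {f g : W ⟶ V}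
    (h : ∀ (A : FinModAlg.{u}ᵒᵖ) (φ : atoms.obj A ⟶ W), φ ≫ f = φ ≫ g) : f = g := by
  refine hom_ext fun w => ?_
  obtain ⟨A, φ, a, rfl⟩ := exists_atoms_point W w
  exact congr_toFun (h A φ) a

instance : presheaf.{u}.Faithful where
  map_injective h := hom_ext_of_atoms fun A φ =>
    congr(($h).app (op A) φ)

instance : presheaf.{u}.Full where
  map_surjective {W V} α := by
    let t (A : FinModAlg.{u}ᵒᵖ) (φ : atoms.obj A ⟶ W) : atoms.obj A ⟶ V := α.app (op A) φ
    have ht {A B : FinModAlg.{u}ᵒᵖ} (f : A ⟶ B) (φ : atoms.obj B ⟶ W) :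
        t A (atoms.map f ≫ φ) = atoms.map f ≫ t B φ :=
      NatTrans.naturality_apply α f.op φ
    choose A φ a ha using exists_atoms_point W
    have key {B : FinModAlg.{u}ᵒᵖ} (ψ : atoms.obj B ⟶ W) (b : atoms.obj B) :
        (t _ (φ (ψ.toFun b))).toFun (a (ψ.toFun b)) = (t B ψ).toFun b :=
      eq_of_compatible (fun A φ a => (t A φ).toFun a) (fun f φ a => congr_toFun (ht f φ) a) (ha _)
    -- Relations are transferred through the finite frame chosen for `w`, where `t _ (φ w)` is a
    -- bounded morphism; `key` makes the values independent of the chosen frames.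
    refine ⟨⟨fun w => (t _ (φ w)).toFun (a w), fun {w v} h => ?_, fun {w c} h => ?_⟩, ?_⟩
    · rw [← ha w] at h
      obtain ⟨b, hb, rfl⟩ := (φ w).back h
      rw [key]
      exact (t _ (φ w)).forth hb
    · obtain ⟨b, hb, rfl⟩ := (t _ (φ w)).back h
      refine ⟨(φ w).toFun b, ?_, key _ _⟩
      have := (φ w).forth hb
      rwa [ha] at this
    · ext B ψ
      exact hom_ext fun b => key ψ b

/-! ### Finite frames are compact. -/

section Compactness

variable {I : Type u} [SmallCategory I] [IsFiltered I] (D : I ⥤ FinModAlg.{u}ᵒᵖ)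
  (c : Cocone (D ⋙ atoms))

/-- The cocone of presheaves induced by a cocone of frames. -/
noncomputable def presheafCocone : Cocone (D ⋙ yoneda) where
  pt := presheaf.obj c.pt
  ι :=
    { app i :=
        { app A := TypeCat.ofHom fun f : A.unop ⟶ D.obj i =>
            (atoms.map f ≫ c.ι.app i : atoms.obj A.unop ⟶ c.pt)
          naturality A B f := by
            ext g
            exact congrArg (· ≫ c.ι.app i) (atoms.map_comp f.unop g)  }
      naturality i j f := by
        ext A g
        change atoms.map (g ≫ D.map f) ≫ c.ι.app j = atoms.map g ≫ c.ι.app i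
        rw [← c.w f, atoms.map_comp, Category.assoc]
        rfl }

variable {D c}

theorem exists_range_of_finite (hc : ∀ w : c.pt, ∃ i x, (c.ι.app i).toFun x = w) {S : Set c.pt}
    (hS : S.Finite) : ∃ i, S ⊆ Set.range (c.ι.app i).toFun := by
  induction S, hS using Set.Finite.induction_on with
  | empty => exact ⟨(IsFiltered.nonempty (C := I)).some, Set.empty_subset _⟩
  | @insert w S _ _ ih =>
    obtain ⟨i, hi⟩ := ih
    obtain ⟨j, x, rfl⟩ := hc w
    refine ⟨IsFiltered.max i j, Set.insert_subset ?_ (hi.trans ?_)⟩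
    · exact ⟨_, congr_toFun (c.w (IsFiltered.rightToMax i j)) x⟩
    · rintro _ ⟨y, rfl⟩
      exact ⟨_, congr_toFun (c.w (IsFiltered.leftToMax i j)) y⟩

/-- Only finitely many pairs of points exist at stage `i`; each pair identified in the cocone is
identified at some later stage, and filteredness gives one stage for all. -/
theorem exists_map_eq (hc : ∀ {i} {x y : atoms.obj (D.obj i)},
      (c.ι.app i).toFun x = (c.ι.app i).toFun y →
        ∃ (k : I) (f : i ⟶ k), (atoms.map (D.map f)).toFun x = (atoms.map (D.map f)).toFun y)
    (i : I) : ∃ (k : I) (f : i ⟶ k), ∀ x y, (c.ι.app i).toFun x = (c.ι.app i).toFun y →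
      (atoms.map (D.map f)).toFun x = (atoms.map (D.map f)).toFun y := by
  suffices ∀ S : Set (atoms.obj (D.obj i) × atoms.obj (D.obj i)), S.Finite →
      ∃ (k : I) (f : i ⟶ k), ∀ p ∈ S, (c.ι.app i).toFun p.1 = (c.ι.app i).toFun p.2 →
        (atoms.map (D.map f)).toFun p.1 = (atoms.map (D.map f)).toFun p.2 by
    obtain ⟨k, f, h⟩ := this Set.univ Set.finite_univ
    exact ⟨k, f, fun x y => h (x, y) trivial⟩
  intro S hS
  induction S, hS using Set.Finite.induction_on with
  | empty => exact ⟨i, 𝟙 i, fun p hp => hp.elim⟩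
  | @insert p S _ _ ih =>
    obtain ⟨k, f, hf⟩ := ih
    by_cases hp : (c.ι.app i).toFun p.1 = (c.ι.app i).toFun p.2
    · obtain ⟨l, g, hg⟩ := hc hp
      obtain ⟨m, f', g', h⟩ := IsFiltered.span f g
      refine ⟨m, f ≫ f', fun q hq hqc => ?_⟩
      obtain rfl | hq := hq
      · rw [h, D.map_comp, atoms.map_comp, comp_toFun, comp_toFun, hg]
      · rw [D.map_comp, atoms.map_comp, comp_toFun, comp_toFun, hf q hq hqc]
    · refine ⟨k, f, fun q hq hqc => ?_⟩
      obtain rfl | hq := hq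
      exacts [absurd hqc hp, hf q hq hqc]

/-- A set-theoretic lift `ψ` of `φ` to a stage `i` respects the relation only up to points
identified in the cocone. Moving to a stage `k` where all these identifications have taken place
makes it a bounded morphism. -/
theorem exists_factor (hc : ∀ w : c.pt, ∃ i x, (c.ι.app i).toFun x = w)
    (hc' : ∀ {i} {x y : atoms.obj (D.obj i)}, (c.ι.app i).toFun x = (c.ι.app i).toFun y →
        ∃ (k : I) (f : i ⟶ k), (atoms.map (D.map f)).toFun x = (atoms.map (D.map f)).toFun y)
    {F : LocFinFrame.{u}} [Finite F] (φ : F ⟶ c.pt) :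
    ∃ (k : I) (s : F ⟶ atoms.obj (D.obj k)), s ≫ c.ι.app k = φ := by
  obtain ⟨i, hi⟩ := exists_range_of_finite hc (Set.finite_range φ.toFun)
  choose ψ hψ using fun x => hi ⟨x, rfl⟩
  obtain ⟨k, f, hf⟩ := exists_map_eq hc' i
  have hw (x) : (c.ι.app k).toFun ((atoms.map (D.map f)).toFun x) = (c.ι.app i).toFun x :=
    congr_toFun (c.w f) x
  refine ⟨k, ⟨fun x => (atoms.map (D.map f)).toFun (ψ x), fun {x y} h => ?_, fun {x z} h => ?_⟩,
    hom_ext fun x => (hw _).trans (hψ x)⟩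
  · have := φ.forth h
    rw [← hψ x] at this
    obtain ⟨z, hz, hzy⟩ := (c.ι.app i).back this
    rw [hf (ψ y) z ((hψ y).trans hzy.symm)]
    exact (atoms.map (D.map f)).forth hz
  · obtain ⟨z, hz, rfl⟩ := (atoms.map (D.map f)).back h
    have := (c.ι.app i).forth hz
    rw [hψ x] at this
    obtain ⟨y, hy, hyz⟩ := φ.back this
    exact ⟨y, hy, hf _ _ ((hψ y).trans hyz)⟩

/-- Finite frames are compact. -/
noncomputable def isColimitPresheafCocone (hc : ∀ w : c.pt, ∃ i x, (c.ι.app i).toFun x = w)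
    (hc' : ∀ {i} {x y : atoms.obj (D.obj i)}, (c.ι.app i).toFun x = (c.ι.app i).toFun y →
        ∃ (k : I) (f : i ⟶ k), (atoms.map (D.map f)).toFun x = (atoms.map (D.map f)).toFun y) :
    IsColimit (presheafCocone D c) :=
  evaluationJointlyReflectsColimits _ fun A => by
    refine Types.FilteredColimit.isColimitOf _ _ (fun φ => ?_) fun i j g h hgh => ?_
    · obtain ⟨k, s, hs⟩ := exists_factor hc hc' (F := atoms.obj A.unop) φ
      refine ⟨k, atoms.preimage s, ?_⟩
      change φ = atoms.map (atoms.preimage s) ≫ c.ι.app k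
      rw [Functor.map_preimage, hs]
    · change A.unop ⟶ D.obj i at g
      change A.unop ⟶ D.obj j at h
      change atoms.map g ≫ c.ι.app i = atoms.map h ≫ c.ι.app j at hgh
      -- Both morphisms are moved to a common stage, then to one where points equal in the cocone
      -- are already equal.
      obtain ⟨k, f, hf⟩ := exists_map_eq hc' (IsFiltered.max i j)
      refine ⟨k, IsFiltered.leftToMax i j ≫ f, IsFiltered.rightToMax i j ≫ f, ?_⟩
      change g ≫ D.map _ = h ≫ D.map _
      refine atoms.map_injective (hom_ext fun a => ?_)
      simp only [Functor.map_comp, comp_toFun]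
      refine hf _ _ ?_
      exact (congr_toFun (c.w (IsFiltered.leftToMax i j)) _).trans ((congr_toFun hgh a).trans
        (congr_toFun (c.w (IsFiltered.rightToMax i j)) _).symm)

end Compactness

/-! #### Every frame is the union of its finite generated subframes -/

/-- The directed set of finite generated subframes. -/
abbrev FiniteUp (W : LocFinFrame.{u}) : Type u := {S : Set W // S.Finite ∧ IsUp S}

instance (W : LocFinFrame.{u}) : Nonempty (FiniteUp W) :=
  ⟨∅, Set.finite_empty, fun _ _ h => h.elim⟩

instance (W : LocFinFrame.{u}) : IsDirectedOrder (FiniteUp W) :=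
  ⟨fun S T => ⟨⟨S ∪ T, S.2.1.union T.2.1, S.2.2.union T.2.2⟩, Set.subset_union_left,
    Set.subset_union_right⟩⟩

instance (W : LocFinFrame.{u}) (S : FiniteUp W) : Finite (W.sub S.1) := S.2.1

/-- A finite generated subframe as the frame of atoms of its modal algebra of subsets. -/
noncomputable def finiteUpIso {W : LocFinFrame.{u}} (S : FiniteUp W) :
    W.sub S.1 ≅ atoms.obj (op (complex (W.sub S.1))) :=
  complexIso _

/-- The diagram of finite generated subframes. -/
noncomputable def finiteUpDiagram (W : LocFinFrame.{u}) : FiniteUp W ⥤ FinModAlg.{u}ᵒᵖ where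
  obj S := op (complex (W.sub S.1))
  map {S T} h := atoms.preimage
    ((finiteUpIso S).inv ≫ inclusion S.2.2 (leOfHom h) ≫ (finiteUpIso T).hom)
  map_id S := atoms.map_injective (by
    rw [Functor.map_preimage, CategoryTheory.Functor.map_id, Iso.inv_comp_eq, Category.comp_id]
    rfl)
  map_comp f g := atoms.map_injective (by
    simp only [Functor.map_preimage, Functor.map_comp, Category.assoc, Iso.hom_inv_id_assoc]
    rfl)

theorem finiteUpDiagram_map {W : LocFinFrame.{u}} {S T : FiniteUp W} (h : S ⟶ T) :
    atoms.map ((finiteUpDiagram W).map h) =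
      (finiteUpIso S).inv ≫ inclusion S.2.2 (leOfHom h) ≫ (finiteUpIso T).hom :=
  Functor.map_preimage _ _

/-- The cocone of finite generated subframes. -/
noncomputable def finiteUpCocone (W : LocFinFrame.{u}) : Cocone (finiteUpDiagram W ⋙ atoms) where
  pt := W
  ι :=
    { app S := (finiteUpIso S).inv ≫ incl S.2.2
      naturality S T h := by
        refine (congrArg (· ≫ (finiteUpIso T).inv ≫ incl T.2.2) (finiteUpDiagram_map h)).trans ?_
        change ((finiteUpIso S).inv ≫ inclusion S.2.2 (leOfHom h) ≫ (finiteUpIso T).hom) ≫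
          (finiteUpIso T).inv ≫ incl T.2.2 = (finiteUpIso S).inv ≫ incl S.2.2
        simp only [Category.assoc, Iso.hom_inv_id_assoc]
        rfl }

/-- Cones are finite and upward closed, so the finite generated subframes cover `W`; their
inclusions are injective, so no later stage is needed for identifications. -/
theorem isIndObject_presheaf (W : LocFinFrame.{u}) : IsIndObject (presheaf.obj W) := by
  refine .mk (IndObjectPresentation.ofCocone _ (isColimitPresheafCocone (c := finiteUpCocone W)
    (fun (w : W) => ?_) fun {S x y} h => ⟨S, 𝟙 S, ?_⟩))
  · let S : FiniteUp W := ⟨_, W.finite_cone w, isUp_cone w⟩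
    refine ⟨S, (finiteUpIso S).hom.toFun ⟨w, .refl⟩, ?_⟩
    exact congr_toFun ((finiteUpIso S).hom_inv_id_assoc (incl (isUp_cone w))) _
  · rw [show x = y from inv_injective (finiteUpIso S) (Subtype.val_injective h)]

/-! #### Filtered colimits of frames -/

/-- The functor of points. -/
def points : LocFinFrame.{u} ⥤ Type u where
  obj W := W
  map f := TypeCat.ofHom f.toFun

section Colimit

variable {I : Type u} [SmallCategory I] (D : I ⥤ LocFinFrame.{u})

/-- The inclusion into the colimit of the sets of points. -/
noncomputable def colimitι (i : I) (x : D.obj i) : colimit (D ⋙ points) :=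
  colimit.ι (D ⋙ points) i x

theorem exists_colimitι (w : colimit (D ⋙ points)) : ∃ i x, colimitι D i x = w :=
  Types.jointly_surjective_of_isColimit (colimit.isColimit (D ⋙ points)) w

theorem colimitι_map {i j : I} (f : i ⟶ j) (x : D.obj i) :
    colimitι D j ((D.map f).toFun x) = colimitι D i x :=
  congr($(colimit.w (D ⋙ points) f) x)

variable [IsFiltered I]

theorem colimitι_eq_iff {i j : I} {x : D.obj i} {y : D.obj j} :
    colimitι D i x = colimitι D j y ↔
      ∃ (k : I) (f : i ⟶ k) (g : j ⟶ k), (D.map f).toFun x = (D.map g).toFun y :=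
  Types.FilteredColimit.colimit_eq_iff (D ⋙ points)

/-- The representatives `p` and `x` agree at a stage `k`; the relation is pushed there along `f` and
pulled back to stage `i` by the back condition of `g`. -/
theorem back_colimitι {i : I} {x : D.obj i} {w : colimit (D ⋙ points)}
    (h : ∃ (j : I) (p q : D.obj j), colimitι D j p = colimitι D i x ∧ colimitι D j q = w ∧
      (D.obj j).rel p q) : ∃ y, (D.obj i).rel x y ∧ colimitι D i y = w := by
  obtain ⟨j, p, q, hp, rfl, h⟩ := h
  obtain ⟨k, f, g, hfg⟩ := (colimitι_eq_iff D).1 hp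
  have h' := (D.map f).forth h
  rw [hfg] at h'
  obtain ⟨y, hy, hyq⟩ := (D.map g).back h'
  refine ⟨y, hy, ?_⟩
  rw [← colimitι_map D g, hyq, colimitι_map]

/-- The colimit of a filtered diagram of frames. -/
noncomputable def colimitFrame : LocFinFrame.{u} where
  carrier := colimit (D ⋙ points)
  rel w v := ∃ (j : I) (p q : D.obj j), colimitι D j p = w ∧ colimitι D j q = v ∧ (D.obj j).rel p q
  finite_cone w := by
    obtain ⟨i, x, rfl⟩ := exists_colimitι D w
    exact (((D.obj i).finite_cone x).image (colimitι D i)).subset fun v h =>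
      exists_reflTransGen_of_back (back_colimitι D) h

/-- The colimit cocone of a filtered diagram of frames. -/
noncomputable def colimitFrameCocone : Cocone D where
  pt := colimitFrame D
  ι :=
    { app i := ⟨colimitι D i, fun {a b} h => ⟨i, a, b, rfl, rfl, h⟩, back_colimitι D⟩
      naturality _ _ f := hom_ext fun x => colimitι_map D f x }

end Colimit

theorem exists_presheaf_iso {X : (FinModAlg.{u}ᵒᵖ)ᵒᵖ ⥤ Type u} (hX : IsIndObject X) :
    ∃ W : LocFinFrame.{u}, Nonempty (presheaf.obj W ≅ X) := by
  let P := hX.presentation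
  refine ⟨_, ⟨IsColimit.coconePointUniqueUpToIso (isColimitPresheafCocone (D := P.F)
    (c := colimitFrameCocone (P.F ⋙ atoms)) (exists_colimitι _) fun {i x y} h => ?_) P.isColimit⟩⟩
  obtain ⟨k, f, g, hfg⟩ := (colimitι_eq_iff (P.F ⋙ atoms)).1 h
  -- Equality in the colimit provides two parallel arrows `f` and `g`; a single transition map is
  -- obtained by coequalizing them.
  refine ⟨IsFiltered.coeq f g, f ≫ IsFiltered.coeqHom f g, ?_⟩
  rw [P.F.map_comp, atoms.map_comp, comp_toFun]
  refine (congrArg _ hfg).trans ?_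
  have := congrArg (fun h => (atoms.map (P.F.map h)).toFun y) (IsFiltered.coeq_condition f g)
  simp only [P.F.map_comp, atoms.map_comp, comp_toFun] at this ⊢
  exact this.symm

/-! #### The equivalence -/

/-- Frames as ind-objects of finite frames. -/
noncomputable def toInd : LocFinFrame.{u} ⥤ Ind FinModAlg.{u}ᵒᵖ :=
  ObjectProperty.lift _ presheaf isIndObject_presheaf ⋙ (Ind.equivalence _).inverse

/-- The underlying presheaf of the ind-object of a frame. -/
noncomputable def toIndCompInclusion : toInd.{u} ⋙ Ind.inclusion _ ≅ presheaf :=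
  Functor.isoWhiskerLeft (ObjectProperty.lift _ _ _)
    (Functor.isoWhiskerRight (Ind.equivalence FinModAlg.{u}ᵒᵖ).counitIso (ObjectProperty.ι _))

instance : toInd.{u}.IsEquivalence where
  faithful := inferInstanceAs (ObjectProperty.lift _ presheaf isIndObject_presheaf ⋙
    (Ind.equivalence _).inverse).Faithful
  full := inferInstanceAs (ObjectProperty.lift _ presheaf isIndObject_presheaf ⋙
    (Ind.equivalence _).inverse).Full
  essSurj :=
    { mem_essImage X := by
        obtain ⟨W, ⟨e⟩⟩ := exists_presheaf_iso X.isIndObject_inclusion_obj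
        exact ⟨W, ⟨Ind.inclusion.fullyFaithful.preimageIso (toIndCompInclusion.app W ≪≫ e)⟩⟩ }

end LocFinFrame

/-! ### The forgetful functor in terms of frames -/

namespace LocFinFrame

open FinModAlg ProFinModAlg

/-- A frame as a profinite modal algebra. -/
noncomputable abbrev toPro (W : LocFinFrame.{u}) : ProFinModAlg.{u} := op (toInd.obj W)

/-- The bounded morphism given by a morphism from the profinite modal algebra of a frame to a finite
modal algebra. -/
noncomputable def ofPro {W : LocFinFrame.{u}} {A : FinModAlg.{u}}
    (x : (toFunctor (toPro W)).obj A) : atoms.obj (op A) ⟶ W :=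
  (toIndCompInclusion.hom.app W).app (op (op A)) x

theorem ofPro_surjective {W : LocFinFrame.{u}} {A : FinModAlg.{u}} :
    Function.Surjective (ofPro (W := W) (A := A)) := by
  have h : IsIso ((toIndCompInclusion.hom.app W).app (op (op A))) := inferInstance
  exact ((isIso_iff_bijective _).1 h).2

theorem ofPro_map {W : LocFinFrame.{u}} {A B : FinModAlg.{u}} (f : A ⟶ B)
    (x : (toFunctor (toPro W)).obj A) :
    ofPro ((toFunctor (toPro W)).map f x) = atoms.map f.op ≫ ofPro x :=
  NatTrans.naturality_apply (toIndCompInclusion.hom.app W) f.op.op x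

theorem ofPro_mapFunctor {W V : LocFinFrame.{u}} (h : W ⟶ V) {A : FinModAlg.{u}}
    (x : (toFunctor (toPro W)).obj A) :
    ofPro ((mapFunctor (toInd.map h).op).app A x) = ofPro x ≫ h :=
  congr($(congr_app (toIndCompInclusion.hom.naturality h) (op (op A))) x)

/-- The point of the profinite modal algebra of `W` given by a subset of `W`. -/
noncomputable def pointOfSet {W : LocFinFrame.{u}} (S : Set W) : Point (toPro W) where
  val A x := join fun a => (ofPro x).toFun a ∈ S
  compat A B f x := ext_atom fun b => by
    rw [le_join, ofPro_map]
    exact (le_join (P := fun a => (ofPro x).toFun a ∈ S)).symm.trans (le_map_iff_atoms f.op b _).symm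

theorem le_pointOfSet {W : LocFinFrame.{u}} {S : Set W} {A : FinModAlg.{u}}
    {x : (toFunctor (toPro W)).obj A} {a : Atom A} :
    a.1 ≤ (pointOfSet S).val A x ↔ (ofPro x).toFun a ∈ S :=
  le_join

theorem exists_ofPro (W : LocFinFrame.{u}) (w : W) :
    ∃ (A : FinModAlg.{u}) (x : (toFunctor (toPro W)).obj A) (a : Atom A),
      (ofPro x).toFun a = w := by
  obtain ⟨A, φ, a, rfl⟩ := exists_atoms_point W w
  obtain ⟨x, rfl⟩ := ofPro_surjective φ
  exact ⟨_, x, a, rfl⟩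

theorem pointOfSet_le_iff {W : LocFinFrame.{u}} {S T : Set W} :
    pointOfSet S ≤ pointOfSet T ↔ S ≤ T := by
  constructor
  · intro h w hw
    obtain ⟨A, x, a, rfl⟩ := exists_ofPro W w
    exact le_pointOfSet.1 ((le_pointOfSet.2 hw).trans (h A x))
  · intro h A x
    refine le_iff_atom_le_imp.2 fun a ha hS => ?_
    exact (le_pointOfSet (a := ⟨a, ha⟩)).2 (h ((le_pointOfSet (a := ⟨a, ha⟩)).1 hS))

/-- Being an atom below the component of `s` is a compatible predicate, so by `eq_of_compatible` it
depends only on the image of the atom in `W` and thus defines a subset of `W`. -/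
theorem pointOfSet_surjective {W : LocFinFrame.{u}} :
    Function.Surjective (pointOfSet (W := W)) := by
  intro s
  choose r hr using fun A : FinModAlg.{u} => ofPro_surjective (W := W) (A := A)
  have hrr {A : FinModAlg.{u}} (x : (toFunctor (toPro W)).obj A) : r A (ofPro x) = x := by
    have h : IsIso ((toIndCompInclusion.hom.app W).app (op (op A))) := inferInstance
    exact ((isIso_iff_bijective _).1 h).1 (hr A _)
  let t (A : FinModAlg.{u}ᵒᵖ) (φ : atoms.obj A ⟶ W) (a : atoms.obj A) : Prop :=
    a.1 ≤ s.val A.unop (r A.unop φ)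
  have ht {A B : FinModAlg.{u}ᵒᵖ} (f : A ⟶ B) (φ : atoms.obj B ⟶ W) (a : atoms.obj A) :
      t A (atoms.map f ≫ φ) a = t B φ ((atoms.map f).toFun a) := by
    have h : r A.unop (atoms.map f ≫ φ) = (toFunctor (toPro W)).map f.unop (r B.unop φ) := by
      rw [← hrr ((toFunctor (toPro W)).map f.unop (r B.unop φ)), ofPro_map, hr]
      rfl
    change (a.1 ≤ _) = (_ ≤ _)
    rw [h, s.compat]
    exact propext (le_map_iff_atoms f a _)
  refine ⟨{w | ∃ (A : FinModAlg.{u}ᵒᵖ) (φ : atoms.obj A ⟶ W) (a : atoms.obj A),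
    φ.toFun a = w ∧ t A φ a}, Point.ext ?_⟩
  funext A x
  refine ext_atom fun a => le_pointOfSet.trans ⟨?_, fun h => ?_⟩
  · rintro ⟨B, φ, b, hb, h⟩
    rw [eq_of_compatible t ht hb] at h
    change a.1 ≤ s.val A (r A (ofPro x)) at h
    rwa [hrr] at h
  · refine ⟨op A, ofPro x, a, rfl, ?_⟩
    change a.1 ≤ s.val A (r A (ofPro x))
    rwa [hrr]

/-- The underlying Boolean algebra of the profinite modal algebra of a frame. -/
noncomputable def setOrderIso (W : LocFinFrame.{u}) : Set W ≃o Carrier (toPro W) :=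
  (show Set W ≃o Point (toPro W) from
    { toEquiv := Equiv.ofBijective pointOfSet
        ⟨fun _ _ h => le_antisymm (pointOfSet_le_iff.1 h.le) (pointOfSet_le_iff.1 h.ge),
          pointOfSet_surjective⟩
      map_rel_iff' := pointOfSet_le_iff }).trans (carrierIso _).symm

theorem setOrderIso_apply {W : LocFinFrame.{u}} (S : Set W) :
    setOrderIso W S = (carrierIso _).symm (pointOfSet S) := rfl

theorem map_pointOfSet {W V : LocFinFrame.{u}} (h : V ⟶ W) (S : Set W) :
    Point.map (toInd.map h).op (pointOfSet S) = pointOfSet (h.toFun ⁻¹' S) := by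
  refine Point.ext (funext fun A => funext fun x => ext_atom fun a => ?_)
  refine Iff.trans ?_ le_pointOfSet.symm
  change a.1 ≤ (pointOfSet S).val A ((mapFunctor (toInd.map h).op).app A x) ↔ _
  rw [le_pointOfSet, ofPro_mapFunctor]
  rfl

theorem carrierMap_setOrderIso {W V : LocFinFrame.{u}} (h : V ⟶ W) (S : Set W) :
    carrierMap (toInd.map h).op (setOrderIso W S) = setOrderIso V (h.toFun ⁻¹' S) := by
  rw [carrierMap_apply, setOrderIso_apply, setOrderIso_apply, OrderIso.apply_symm_apply,
    map_pointOfSet]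

end LocFinFrame

/-- An isomorphism of complete atomic Boolean algebras from an order isomorphism. -/
def CABA.isoOfOrderIso {A B : CABA.{u}} (e : A ≃o B) : A ≅ B where
  hom := ⟨(e : CompleteLatticeHom A B)⟩
  inv := ⟨(e.symm : CompleteLatticeHom B A)⟩
  hom_inv_id := CABA.hom_ext e.symm_apply_apply
  inv_hom_id := CABA.hom_ext e.apply_symm_apply

namespace LocFinFrame

open FinModAlg ProFinModAlg

/-- The forgetful functor sends the profinite modal algebra of a frame to its powerset. -/
noncomputable def powersetIso : toInd.{u}.op ⋙ toCABA ≅ powerset :=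
  (NatIso.ofComponents (fun W => CABA.isoOfOrderIso (setOrderIso W.unop)) fun {W V} f => by
    refine CABA.hom_ext fun S => ?_
    exact (carrierMap_setOrderIso f.unop S).symm).symm

end LocFinFrame

/-! ### Monadicity -/

/-- The reflexive monadicity theorem along an equivalence of categories. -/
theorem nonempty_monadicRightAdjoint_of_equivalence {C D E : Type*} [Category.{v} C]
    [Category.{v} D] [Category.{v} E] (F : C ⥤ D) [F.IsEquivalence] (G : C ⥤ E) (H : D ⥤ E) (i : F ⋙ H ≅ G)
    [G.IsRightAdjoint] [G.ReflectsIsomorphisms] [HasReflexiveCoequalizers C]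
    [Monad.PreservesColimitOfIsReflexivePair G] : Nonempty (MonadicRightAdjoint H) := by
  -- Up to isomorphism `H` is `G` precomposed with the inverse equivalence; the hypotheses on `C`
  -- and `G` are carried across it.
  let j : F.inv ⋙ G ≅ H := Functor.isoWhiskerLeft F.inv i.symm ≪≫
    (Functor.associator _ _ _).symm ≪≫ Functor.isoWhiskerRight F.asEquivalence.counitIso H ≪≫
      H.leftUnitor
  have hr {X Y : D} (f g : X ⟶ Y) [IsReflexivePair f g] :
      IsReflexivePair (F.inv.map f) (F.inv.map g) :=
    .mk' (F.inv.map (commonSection f g)) (by rw [← F.inv.map_comp, section_comp_left, F.inv.map_id])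
      (by rw [← F.inv.map_comp, section_comp_right, F.inv.map_id])
  let d {X Y : D} (f g : X ⟶ Y) :
      parallelPair f g ⋙ F.inv ≅ parallelPair (F.inv.map f) (F.inv.map g) :=
    diagramIsoParallelPair _
  have : H.IsRightAdjoint := Functor.isRightAdjoint_of_iso j
  have : H.ReflectsIsomorphisms := reflectsIsomorphisms_of_iso j
  have : HasReflexiveCoequalizers D := ⟨fun X Y f g _ => by
    have := hr f g
    have : HasColimit (parallelPair (F.inv.map f) (F.inv.map g)) :=
      HasReflexiveCoequalizers.has_coeq _ _
    have : HasColimit (parallelPair f g ⋙ F.inv) := hasColimit_of_iso (d f g)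
    exact Adjunction.hasColimit_of_comp_equivalence _ F.inv⟩
  have : Monad.PreservesColimitOfIsReflexivePair H := ⟨fun X Y f g _ => by
    have := hr f g
    have : PreservesColimit (parallelPair f g ⋙ F.inv) G :=
      preservesColimit_of_iso_diagram G (d f g).symm
    exact preservesColimit_of_natIso _ j⟩
  exact ⟨Monad.monadicOfHasPreservesReflexiveCoequalizersOfReflectsIsomorphisms
    (Adjunction.ofIsRightAdjoint H)⟩

theorem mainTheorem1 :
    Nonempty (MonadicRightAdjoint ProFinModAlg.toCABA.{u}) ∧
      Nonempty (MonadicRightAdjoint ProFinModAlg.toType.{u}) :=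
  ⟨nonempty_monadicRightAdjoint_of_equivalence LocFinFrame.toInd.op LocFinFrame.powerset _
      LocFinFrame.powersetIso,
    nonempty_monadicRightAdjoint_of_equivalence LocFinFrame.toInd.op
      (LocFinFrame.powerset ⋙ forget CABA) _
      (Functor.isoWhiskerRight LocFinFrame.powersetIso (forget CABA))⟩
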